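/- Let $A\in\mathbb{R}^{m\times n}$, $m\ge n$, have the singular value decomposition $A=U\begin{pmatrix}\Sigma\\ 0\end{pmatrix}V^T$ with orthogonal $U=(u_1,\dots,u_m)$, $V=(v_1,\dots,v_n)$ and $\Sigma=\mathrm{diag}(\sigma_1,\dots,\sigma_n)$, $\sigma_1>\cdots>\sigma_n>0$. Let $b=\hat b+e\in\mathbb{R}^m$, where $\hat b$ satisfies the discrete Picard condition $|u_i^T\hat b|=\sigma_i^{1+\beta}$, $i=1,\dots,n$, for some $\beta>0$, and assume that the numbers $|u_1^Tb|\ge|u_2^Tb|\ge\cdots\ge|u_n^Tb|>0$ are nonzero and nonincreasing. Suppose that, with a constant $\zeta>0$, either $\sigma_i=\zeta\rho^{-i}$ for $i=1,\dots,n$ with $\rho>1$ (severely ill-posed), or $\sigma_i=\zeta i^{-\alpha}$ for $i=1,\dots,n$ with $\alpha>1$ (moderately ill-posed). Let $B_k\in\mathbb{R}^{(k+1)\times k}$ be the lower bidiagonal matrix produced by $k$ steps of Lanczos bidiagonalization of $A$ started with $p_1=b/\|b\|$: with $\beta_1q_0=0$, for $j=1,\dots,k$ put $r=A^Tp_j-\beta_jq_{j-1}$,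 $\alpha_j=\|r\|$, $q_j=r/\alpha_j$, $z=Aq_j-\alpha_jp_j$, $\beta_{j+1}=\|z\|$, $p_{j+1}=z/\beta_{j+1}$; then $B_k$ has diagonal $\alpha_1,\dots,\alpha_k$ and subdiagonal $\beta_2,\dots,\beta_{k+1}$. Let $\theta_1^{(k)}\ge\cdots\ge\theta_k^{(k)}$ be its singular values (the Ritz values). Let $\Delta_k=D_2T_{k2}T_{k1}^{-1}D_1^{-1}\in\mathbb{R}^{(n-k)\times k}$, where $D_1=\mathrm{diag}(\sigma_iu_i^Tb)_{i\le k}$, $D_2=\mathrm{diag}(\sigma_iu_i^Tb)_{i>k}$, and $T_{k1}$, $T_{k2}$ consist of the first $k$ and the last $n-k$ rows of the $n\times k$ matrix $(\sigma_i^{2(j-1)})_{i,j}$. With $\Sigma_k=\mathrm{diag}(\sigma_1,\dots,\sigma_k)$ and the matrix 2-norm, define $\eta_k\ge 0$ by $$\eta_k^2\sigma_{k+1}^2=\|\Sigma_k(I+\Delta_k^T\Delta_k)^{-1}\Delta_k^T\Delta_k\|^2+\|\Sigma_k(I+\Delta_k^T\Delta_k)^{-1}\Delta_k^T\|^2 .$$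 Then for every $k=1,\dots,n-1$ the Ritz values are simple, $\theta_1^{(k)}>\cdots>\theta_k^{(k)}$, and $$0<\sigma_i-\theta_i^{(k)}\le\sqrt{1+\eta_k^2}\,\sigma_{k+1},\qquad i=1,\dots,k.$$ Moreover, let $1\le k_0\le n-1$ (for instance the transition index at which the noise starts to dominate the coefficients $u_i^Tb$). If the problem is severely ill-posed with $\rho\ge 1+\sqrt2$, or moderately ill-posed with $$1+\sqrt{1+\eta_k^2}<\left(\frac{k_0+1}{k_0}\right)^{\alpha},\qquad k=1,\dots,k_0,$$ then for all $k=1,\dots,k_0$ $$\sigma_{i+1}<\theta_i^{(k)}<\sigma_i,\qquad i=1,\dots,k,$$ and no Ritz value $\theta_i^{(k)}$, $1\le i\le k\le k_0$, is smaller than $\sigma_{k_0+1}$. -/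

import Mathlib

open scoped Matrix

noncomputable section

/-- The `m × n` matrix with `σ 1, …, σ n` on its main diagonal and zeros elsewhere (`σ` is indexed
from `1`). -/
def rectDiag (m n : ℕ) (σ : ℕ → ℝ) : Matrix (Fin m) (Fin n) ℝ :=
  Matrix.of fun i j => if (i : ℕ) = (j : ℕ) then σ (j + 1) else 0

/-- `A = U (Σ; 0) Vᵀ` is a singular value decomposition, with simple positive singular values
`σ 1 > σ 2 > ⋯ > σ n > 0`.  Only the values `σ 1, …, σ n` of `σ` matter. -/
structure IsSVD {m n : ℕ} (A : Matrix (Fin m) (Fin n) ℝ) (U : Matrix (Fin m) (Fin m) ℝ)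
    (σ : ℕ → ℝ) (V : Matrix (Fin n) (Fin n) ℝ) : Prop where
  le : n ≤ m
  left_orthogonal : U ∈ Matrix.orthogonalGroup (Fin m) ℝ
  right_orthogonal : V ∈ Matrix.orthogonalGroup (Fin n) ℝ
  eq : A = U * rectDiag m n σ * Vᵀ
  pos : ∀ i, 1 ≤ i → i ≤ n → 0 < σ i
  decreasing : ∀ i, 1 ≤ i → i + 1 ≤ n → σ (i + 1) < σ i

/-- The Fourier coefficient `u_iᵀ b`, where `u_i` is the `i`-th column of `U`, `1 ≤ i ≤ m`. -/
def leftCoeff {m : ℕ} (U : Matrix (Fin m) (Fin m) ℝ) (b : EuclideanSpace ℝ (Fin m))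
    (i : ℕ) : ℝ :=
  if h : i - 1 < m then ∑ l, U l ⟨i - 1, h⟩ * b l else 0

/-- Severely ill-posed model: `σ i = ζ ρ ^ (-i)` for `1 ≤ i ≤ n`, with `ρ > 1`. -/
def SevereModel (n : ℕ) (σ : ℕ → ℝ) (ζ ρ : ℝ) : Prop :=
  1 < ρ ∧ ∀ i : ℕ, 1 ≤ i → i ≤ n → σ i = ζ * ρ ^ (-(i : ℤ))

/-- Moderately ill-posed model: `σ i = ζ i ^ (-α)` for `1 ≤ i ≤ n`, with `α > 1`. -/
def ModerateModel (n : ℕ) (σ : ℕ → ℝ) (ζ α : ℝ) : Prop :=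
  1 < α ∧ ∀ i : ℕ, 1 ≤ i → i ≤ n → σ i = ζ * (i : ℝ) ^ (-α)

/-! ### Lanczos bidiagonalization -/

/-- The data carried along by the Lanczos bidiagonalization process: after `j` steps,
`p = p_{j+1}`, `q = q_j`, `α = α_j`, `β = β_{j+1}`. -/
structure LanczosState (m n : ℕ) where
  p : EuclideanSpace ℝ (Fin m)
  q : EuclideanSpace ℝ (Fin n)
  α : ℝ
  β : ℝ

/-- One step of Lanczos bidiagonalization:
`r = Aᵀ p_j - β_j q_{j-1}`, `α_j = ‖r‖`, `q_j = r / α_j`,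
`z = A q_j - α_j p_j`, `β_{j+1} = ‖z‖`, `p_{j+1} = z / β_{j+1}`. -/
def lanczosStep {m n : ℕ} (A : Matrix (Fin m) (Fin n) ℝ) (s : LanczosState m n) :
    LanczosState m n :=
  let r := Matrix.toEuclideanLin Aᵀ s.p - s.β • s.q
  let q := ‖r‖⁻¹ • r
  let z := Matrix.toEuclideanLin A q - ‖r‖ • s.p
  { p := ‖z‖⁻¹ • z, q := q, α := ‖r‖, β := ‖z‖ }

/-- The state after `j` steps, started from `p_1 = b / ‖b‖` and `β_1 q_0 = 0`. -/
def lanczosState {m n : ℕ} (A : Matrix (Fin m) (Fin n) ℝ) (b : EuclideanSpace ℝ (Fin m)) :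
    ℕ → LanczosState m n
  | 0 => { p := ‖b‖⁻¹ • b, q := 0, α := 0, β := 0 }
  | j + 1 => lanczosStep A (lanczosState A b j)

/-- The lower bidiagonal matrix `B_k` of size `(k + 1) × k`, with diagonal `α_1, …, α_k` and
subdiagonal `β_2, …, β_{k+1}`. -/
def lanczosB {m n : ℕ} (A : Matrix (Fin m) (Fin n) ℝ) (b : EuclideanSpace ℝ (Fin m)) (k : ℕ) :
    Matrix (Fin (k + 1)) (Fin k) ℝ :=
  Matrix.of fun i j =>
    if (i : ℕ) = (j : ℕ) then (lanczosState A b (j + 1)).α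
    else if (i : ℕ) = (j : ℕ) + 1 then (lanczosState A b (j + 1)).β
    else 0

/-- The Ritz value `θ_i^{(k)}`, `1 ≤ i ≤ k`: the `i`-th largest singular value of `B_k`. -/
def ritzValue {m n : ℕ} (A : Matrix (Fin m) (Fin n) ℝ) (b : EuclideanSpace ℝ (Fin m))
    (k i : ℕ) : ℝ :=
  (Matrix.toEuclideanLin (lanczosB A b k)).singularValues (i - 1)

/-! ### The quantity `η_k` -/

/-- Indices of the first `k` singular values. -/
abbrev isHead {n : ℕ} (k : ℕ) (j : Fin n) : Prop := (j : ℕ) < k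

/-- Indices of the last `n - k` singular values. -/
abbrev isTail {n : ℕ} (k : ℕ) (j : Fin n) : Prop := ¬ (j : ℕ) < k

/-- `D = diag(σ_i u_iᵀ b)`, `1 ≤ i ≤ n`. -/
def krylovD {m : ℕ} (n : ℕ) (U : Matrix (Fin m) (Fin m) ℝ) (σ : ℕ → ℝ)
    (b : EuclideanSpace ℝ (Fin m)) : Matrix (Fin n) (Fin n) ℝ :=
  Matrix.diagonal fun i => σ (i + 1) * leftCoeff U b (i + 1)

/-- The Vandermonde matrix with rows `(1, σ_i², σ_i⁴, …, σ_i^{2n-2})`, `1 ≤ i ≤ n`; its first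
`k` columns form `T_k`. -/
def krylovT (n : ℕ) (σ : ℕ → ℝ) : Matrix (Fin n) (Fin n) ℝ :=
  Matrix.vandermonde fun i : Fin n => σ (i + 1) ^ 2

/-- `Δ_k = D_2 T_{k2} T_{k1}⁻¹ D_1⁻¹`, an `(n - k) × k` matrix, where
`D = diag(D_1, D_2)` and `T_k = (T_{k1}; T_{k2})` are split after the `k`-th row. -/
def krylovDelta {m : ℕ} (n : ℕ) (U : Matrix (Fin m) (Fin m) ℝ) (σ : ℕ → ℝ)
    (b : EuclideanSpace ℝ (Fin m)) (k : ℕ) :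
    Matrix {j : Fin n // isTail k j} {j : Fin n // isHead k j} ℝ :=
  (krylovD n U σ b).toBlock (isTail k) (isTail k) *
    (krylovT n σ).toBlock (isTail k) (isHead k) *
    ((krylovT n σ).toBlock (isHead k) (isHead k))⁻¹ *
    ((krylovD n U σ b).toBlock (isHead k) (isHead k))⁻¹

/-- `Σ_k = diag(σ_1, …, σ_k)`. -/
def headSigma (n : ℕ) (σ : ℕ → ℝ) (k : ℕ) :
    Matrix {j : Fin n // isHead k j} {j : Fin n // isHead k j} ℝ :=
  Matrix.diagonal fun j => σ ((j : Fin n) + 1)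

open scoped Matrix.Norms.L2Operator in
/-- `ε_k = (‖Σ_k (I + Δ_kᵀ Δ_k)⁻¹ Δ_kᵀ Δ_k‖² + ‖Σ_k (I + Δ_kᵀ Δ_k)⁻¹ Δ_kᵀ‖²)^{1/2}`, with the
matrix 2-norm. -/
def epsilonK {m : ℕ} (n : ℕ) (U : Matrix (Fin m) (Fin m) ℝ) (σ : ℕ → ℝ)
    (b : EuclideanSpace ℝ (Fin m)) (k : ℕ) : ℝ :=
  let Δ := krylovDelta n U σ b k
  √(‖headSigma n σ k * (1 + Δᵀ * Δ)⁻¹ * (Δᵀ * Δ)‖ ^ 2 +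
    ‖headSigma n σ k * (1 + Δᵀ * Δ)⁻¹ * Δᵀ‖ ^ 2)

/-- `η_k`, defined by `ε_k = η_k σ_{k+1}`. -/
def etaK {m : ℕ} (n : ℕ) (U : Matrix (Fin m) (Fin m) ℝ) (σ : ℕ → ℝ)
    (b : EuclideanSpace ℝ (Fin m)) (k : ℕ) : ℝ :=
  epsilonK n U σ b k / σ (k + 1)

end

/-! In the coordinates of the right singular vectors, the `k`-th Krylov space of `AᵀA` and `Aᵀb`
consists of the vectors `(s_l c_l p(s_l²))_l` with `deg p < k`. Since the `s_l` are distinct and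
positive and the `c_l` nonzero, a nonzero polynomial of degree below `n` gives a nonzero vector.
Hence Lanczos does not break down for `k < n`, and the `θ_i²` are the Rayleigh–Ritz values of
`diag(s²)` on this space (`exists_isRitzSystem`).

Simplicity and `θ_i < σ_i` combine Rayleigh quotients with root counting (`strictAnti`,
`lt_singularValue`). For the error bound, the Krylov space is the graph of `Δ_k` over the first `k`
coordinates, so the residual of projecting a head vector onto it is explicit: weighted by the
singular values, its head part is at most `ε_k` and its tail part at most `σ_{k+1}`, relative to the
vector (`projection_energy_le`). A min-max argument turns this into `σ_i - θ_i ≤ √(1 + η_k²)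
σ_{k+1}` (`sub_le_of_projection`).

For `σ_{i+1} < θ_i^{(k)}`, the `i`-th Krylov space lies in the `k`-th, so it is enough that every
Rayleigh quotient on the `i`-th space exceeds `σ_{i+1}²` (`lt_of_forall_energy`). In the moderate
case the error bound at step `i` gives this. In the severe case `η` plays no role: a polynomial
bound on geometric nodes shows that the tail of the spectrum cannot outweigh its head
(`geometric_energy_pos`). -/

section RitzValues

open Polynomial

/-! ### Rayleigh–Ritz approximation on Krylov spaces -/

section Krylov

/-- The min-max arguments below pick their test vectors by this dimension count. -/
theorem exists_ne_zero_forall_eq_zero {V ι : Type*} [AddCommGroup V] [Module ℝ V]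
    [FiniteDimensional ℝ V] [Fintype ι] (f : ι → V →ₗ[ℝ] ℝ)
    (h : Fintype.card ι < Module.finrank ℝ V) : ∃ x : V, x ≠ 0 ∧ ∀ i, f i x = 0 := by
  have hk : LinearMap.ker (LinearMap.pi f) ≠ ⊥ :=
    LinearMap.ker_ne_bot_of_finrank_lt (by simpa using h)
  obtain ⟨x, hx, hx0⟩ := (Submodule.ne_bot_iff _).1 hk
  exact ⟨x, hx0, fun i => by simpa using congrFun (LinearMap.mem_ker.1 hx) i⟩

theorem finrank_degreeLT (k : ℕ) : Module.finrank ℝ (degreeLT ℝ k) = k := by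
  rw [(degreeLTEquiv ℝ k).finrank_eq]; simp

instance finiteDimensional_degreeLT (k : ℕ) : FiniteDimensional ℝ (degreeLT ℝ k) :=
  (degreeLTEquiv ℝ k).symm.finiteDimensional

/-- In the coordinates of the right singular vectors, `krylovMap s c p` is `p(AᵀA) Aᵀ b`, where `s`
are the singular values and `c` the coefficients of `b`. -/
def krylovMap {n : ℕ} (s c : Fin n → ℝ) : ℝ[X] →ₗ[ℝ] (Fin n → ℝ) where
  toFun p l := s l * c l * p.eval (s l ^ 2)
  map_add' p q := by ext l; simp [mul_add]
  map_smul' a p := by ext l; simp; ring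

@[simp]
theorem krylovMap_apply {n : ℕ} (s c : Fin n → ℝ) (p : ℝ[X]) (l : Fin n) :
    krylovMap s c p l = s l * c l * p.eval (s l ^ 2) := rfl

/-- Strictly decreasing positive singular values and nonzero coefficients. -/
structure IsSpectralData {n : ℕ} (s c : Fin n → ℝ) : Prop where
  pos : ∀ l, 0 < s l
  anti : StrictAnti s
  coeff_ne : ∀ l, c l ≠ 0

namespace IsSpectralData

variable {n : ℕ} {s c : Fin n → ℝ}

theorem sq_injective (h : IsSpectralData s c) : Function.Injective fun l => s l ^ 2 :=
  fun a b hab => h.anti.injective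
    ((pow_left_inj₀ (h.pos a).le (h.pos b).le two_ne_zero).1 hab)

theorem eq_zero_of_card (h : IsSpectralData s c) {p : ℝ[X]} (S : Finset (Fin n))
    (hp : p.degree < S.card) (h0 : ∀ l ∈ S, krylovMap s c p l = 0) : p = 0 := by
  refine Polynomial.eq_zero_of_degree_lt_of_eval_index_eq_zero S (v := fun l => s l ^ 2)
    h.sq_injective.injOn hp fun l hl => ?_
  have := h0 l hl
  simpa [(h.pos l).ne', h.coeff_ne l] using this

theorem eq_zero (h : IsSpectralData s c) {p : ℝ[X]} (hp : p.degree < n)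
    (h0 : krylovMap s c p = 0) : p = 0 :=
  h.eq_zero_of_card Finset.univ (by simpa using hp) fun l _ => congrFun h0 l

end IsSpectralData

/-- Covers both norms (`w = 1`, hence the factor `1 *` in `IsRitzSystem.orthonormal`) and energies
(`w = s²`). -/
theorem weighted_sum_sq {n k : ℕ} {w : Fin n → ℝ} {g : Fin k → Fin n → ℝ} {d : Fin k → ℝ}
    (h : ∀ i j, ∑ l, w l * (g i l * g j l) = if i = j then d i else 0) (y : Fin k → ℝ) :
    ∑ l, w l * (∑ i, y i * g i l) ^ 2 = ∑ i, d i * y i ^ 2 := by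
  have : ∀ l, w l * (∑ i, y i * g i l) ^ 2
      = ∑ i, ∑ j, y i * y j * (w l * (g i l * g j l)) := fun l => by
    rw [sq, Finset.sum_mul_sum, Finset.mul_sum]
    refine Finset.sum_congr rfl fun i _ => ?_
    rw [Finset.mul_sum]
    exact Finset.sum_congr rfl fun j _ => by ring
  simp_rw [this]
  rw [Finset.sum_comm]
  refine Finset.sum_congr rfl fun i _ => ?_
  rw [Finset.sum_comm]
  simp_rw [← Finset.mul_sum, h]
  simp
  ring

/-- An orthonormal basis `g` of the `k`-th Krylov space which diagonalizes the compression of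
`diag(s²)` to it, with eigenvalues `θ²`. -/
structure IsRitzSystem {n : ℕ} (s c : Fin n → ℝ) {k : ℕ} (g : Fin k → Fin n → ℝ)
    (θ : Fin k → ℝ) : Prop where
  orthonormal : ∀ i j, ∑ l, 1 * (g i l * g j l) = if i = j then 1 else 0
  energy : ∀ i j, ∑ l, s l ^ 2 * (g i l * g j l) = if i = j then θ i ^ 2 else 0
  mem : ∀ i, ∃ p ∈ degreeLT ℝ k, krylovMap s c p = g i
  antitone : Antitone θ
  nonneg : ∀ i, 0 ≤ θ i

namespace IsRitzSystem

variable {n : ℕ} {s c : Fin n → ℝ} {k : ℕ} {g : Fin k → Fin n → ℝ} {θ : Fin k → ℝ}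

theorem sum_sq (h : IsRitzSystem s c g θ) (y : Fin k → ℝ) :
    ∑ l, (∑ i, y i * g i l) ^ 2 = ∑ i, y i ^ 2 := by
  simpa using weighted_sum_sq h.orthonormal y

theorem sum_energy (h : IsRitzSystem s c g θ) (y : Fin k → ℝ) :
    ∑ l, s l ^ 2 * (∑ i, y i * g i l) ^ 2 = ∑ i, θ i ^ 2 * y i ^ 2 :=
  weighted_sum_sq h.energy y

theorem sum_mul (h : IsRitzSystem s c g θ) (y : Fin k → ℝ) (j : Fin k) :
    ∑ l, (∑ i, y i * g i l) * g j l = y j := by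
  simp_rw [Finset.sum_mul]
  rw [Finset.sum_comm]
  have : ∀ i, ∑ l, y i * g i l * g j l = y i * if i = j then 1 else 0 := fun i => by
    rw [← h.orthonormal i j, Finset.mul_sum]
    exact Finset.sum_congr rfl fun l _ => by ring
  simp [this]

theorem combination_mem (h : IsRitzSystem s c g θ) (y : Fin k → ℝ) :
    ∃ p ∈ degreeLT ℝ k, ∀ l, krylovMap s c p l = ∑ i, y i * g i l := by
  choose p hp hpg using h.mem
  refine ⟨∑ i, y i • p i, Submodule.sum_mem _ fun i _ => Submodule.smul_mem _ _ (hp i), fun l => ?_⟩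
  rw [map_sum, Finset.sum_apply]
  exact Finset.sum_congr rfl fun i _ => by rw [map_smul, hpg]; rfl

/-- The `k` orthonormal vectors are independent, so lifting their combinations to polynomials is
injective into a space of dimension `k`, hence onto. -/
theorem exists_combination (h : IsRitzSystem s c g θ) {p : ℝ[X]} (hp : p ∈ degreeLT ℝ k) :
    ∃ y : Fin k → ℝ, ∀ l, krylovMap s c p l = ∑ i, y i * g i l := by
  choose q hq hqg using h.mem
  let T : (Fin k → ℝ) →ₗ[ℝ] degreeLT ℝ k :=
    Fintype.linearCombination ℝ fun i => (⟨q i, hq i⟩ : degreeLT ℝ k)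
  have hT : ∀ y l, krylovMap s c (T y : ℝ[X]) l = ∑ i, y i * g i l := fun y l => by
    simp only [T, Fintype.linearCombination_apply, Submodule.coe_sum, Submodule.coe_smul]
    rw [map_sum, Finset.sum_apply]
    exact Finset.sum_congr rfl fun i _ => by rw [map_smul, hqg]; rfl
  have hinj : Function.Injective T := by
    rw [← LinearMap.ker_eq_bot, LinearMap.ker_eq_bot']
    intro y hy
    ext j
    rw [← h.sum_mul y j]
    simp_rw [← hT, hy]
    simp
  have hsurj : Function.Surjective T :=
    (LinearMap.injective_iff_surjective_of_finrank_eq_finrank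
      (by rw [finrank_degreeLT]; simp)).1 hinj
  obtain ⟨y, hy⟩ := hsurj ⟨p, hp⟩
  exact ⟨y, fun l => by rw [← hT, hy]⟩

/-- If two Ritz values agree, some nontrivial combination of their Ritz vectors has a polynomial `r`
without top coefficient. Then `(X - θ²) r` still gives a Krylov vector, yet one orthogonal to the
whole Krylov space, so it vanishes, and `r = 0`. -/
theorem strictAnti (hd : IsSpectralData s c) (h : IsRitzSystem s c g θ) (hk : k ≤ n) :
    StrictAnti θ := by
  intro i j hij
  refine lt_of_le_of_ne (h.antitone hij.le) fun heq => ?_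
  obtain ⟨p, hp, hpg⟩ := h.mem i
  obtain ⟨q, hq, hqg⟩ := h.mem j
  have hk0 : 0 < k := i.pos
  obtain ⟨a, b, hab, htop⟩ : ∃ a b : ℝ, (a ≠ 0 ∨ b ≠ 0) ∧
      a * p.coeff (k - 1) + b * q.coeff (k - 1) = 0 := by
    by_cases h0 : p.coeff (k - 1) = 0
    · exact ⟨1, 0, by simp, by simp [h0]⟩
    · exact ⟨q.coeff (k - 1), -p.coeff (k - 1), Or.inr (neg_ne_zero.2 h0), by ring⟩
  set r : ℝ[X] := a • p + b • q with hr
  have hrk : r ∈ degreeLT ℝ k :=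
    Submodule.add_mem _ (Submodule.smul_mem _ _ hp) (Submodule.smul_mem _ _ hq)
  have hrdeg : r.degree < (k - 1 : ℕ) := by
    rw [degree_lt_iff_coeff_zero]
    intro m hm
    rcases hm.eq_or_lt with rfl | hm
    · simpa [hr] using htop
    · exact (degree_lt_iff_coeff_zero _ _).1 (mem_degreeLT.1 hrk) m (by omega)
  have hx : ∀ l, krylovMap s c r l = a * g i l + b * g j l := fun l => by
    rw [hr, map_add, map_smul, map_smul, hpg, hqg]; rfl
  set t := θ i ^ 2 with ht
  have hRdeg : ((X - C t) * r) ∈ degreeLT ℝ k := by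
    rw [mem_degreeLT]
    by_cases hr0 : r = 0
    · simp [hr0]
    · rw [degree_mul, degree_X_sub_C, degree_eq_natDegree hr0]
      rw [degree_eq_natDegree hr0] at hrdeg
      norm_cast at hrdeg ⊢
      omega
  have hR : ∀ l, krylovMap s c ((X - C t) * r) l = (s l ^ 2 - t) * (a * g i l + b * g j l) :=
    fun l => by rw [← hx]; simp; ring
  obtain ⟨y, hy⟩ := h.exists_combination hRdeg
  have hy0 : ∀ m, y m = 0 := fun m => by
    rw [← h.sum_mul y m]
    simp_rw [← hy, hR]
    have e1 := h.energy i m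
    have e2 := h.energy j m
    have o1 := h.orthonormal i m
    have o2 := h.orthonormal j m
    have : ∑ l, (s l ^ 2 - t) * (a * g i l + b * g j l) * g m l
        = a * (∑ l, s l ^ 2 * (g i l * g m l)) + b * (∑ l, s l ^ 2 * (g j l * g m l))
          - t * (a * (∑ l, 1 * (g i l * g m l)) + b * ∑ l, 1 * (g j l * g m l)) := by
      simp only [Finset.mul_sum, ← Finset.sum_add_distrib, ← Finset.sum_sub_distrib]
      exact Finset.sum_congr rfl fun l _ => by ring
    rw [this, e1, e2, o1, o2, heq, ← ht]
    split_ifs <;> ring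
  have hzero : (X - C t) * r = 0 := by
    refine hd.eq_zero ((mem_degreeLT.1 hRdeg).trans_le (by exact_mod_cast hk)) ?_
    ext l
    rw [hy]
    simp [hy0]
  have hr0 : r = 0 := (mul_eq_zero.1 hzero).resolve_left (X_sub_C_ne_zero t)
  have hcomb : ∀ l, a * g i l + b * g j l = 0 := fun l => by rw [← hx, hr0]; simp
  have o1 := h.orthonormal i i
  have o2 := h.orthonormal j j
  have o3 := h.orthonormal i j
  have o4 := h.orthonormal j i
  rw [if_pos rfl] at o1 o2
  rw [if_neg hij.ne] at o3
  rw [if_neg hij.ne'] at o4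
  have ha : a = 0 := by
    have : ∑ l, (a * g i l + b * g j l) * g i l
        = a * (∑ l, 1 * (g i l * g i l)) + b * ∑ l, 1 * (g j l * g i l) := by
      simp only [Finset.mul_sum, ← Finset.sum_add_distrib]
      exact Finset.sum_congr rfl fun l _ => by ring
    rw [o1, o4] at this
    simpa [hcomb] using this.symm
  have hb : b = 0 := by
    have : ∑ l, (a * g i l + b * g j l) * g j l
        = a * (∑ l, 1 * (g i l * g j l)) + b * ∑ l, 1 * (g j l * g j l) := by
      simp only [Finset.mul_sum, ← Finset.sum_add_distrib]
      exact Finset.sum_congr rfl fun l _ => by ring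
    rw [o2, o3] at this
    simpa [hcomb] using this.symm
  exact hab.elim (fun h => h ha) fun h => h hb

/-- Some nonzero combination of the Ritz vectors up to index `i` has its coordinates before `i`
equal to zero. Its energy is at least `θ i ^ 2` and at most `s i ^ 2` times its squared norm. -/
theorem lt_singularValue (hd : IsSpectralData s c) (h : IsRitzSystem s c g θ) (hk : k < n)
    (i : Fin k) : θ i < s (i.castLE hk.le) := by
  by_contra! hle
  obtain ⟨y, hy0, hy⟩ := exists_ne_zero_forall_eq_zero (V := Fin k → ℝ)
    (ι := {j : Fin k // j ≠ i})
    (fun j => if i < j.1 then LinearMap.proj j.1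
      else ∑ m, g m (j.1.castLE hk.le) • LinearMap.proj m)
    (by simp [Fintype.card_subtype_compl]; exact i.pos)
  have hyi : ∀ j, i < j → y j = 0 := fun j hj => by simpa [hj] using hy ⟨j, hj.ne'⟩
  obtain ⟨p, hp, hpx⟩ := h.combination_mem y
  have hxi : ∀ l : Fin n, (l : ℕ) < i → krylovMap s c p l = 0 := fun l hl => by
    have hlk : (l : ℕ) < k := hl.trans i.2
    have hli : ¬ i < (⟨l, hlk⟩ : Fin k) := by rw [Fin.lt_def]; simpa using hl.le
    have := hy ⟨⟨l, hlk⟩, fun e => by rw [← e] at hl; simp at hl⟩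
    simp only [hli, if_false] at this
    rw [hpx, ← this]
    simp [mul_comm]
  have hn : ∑ l, krylovMap s c p l ^ 2 = ∑ j, y j ^ 2 := by simp_rw [hpx]; exact h.sum_sq y
  have he : ∑ l, s l ^ 2 * krylovMap s c p l ^ 2 = ∑ j, θ j ^ 2 * y j ^ 2 := by
    simp_rw [hpx]; exact h.sum_energy y
  have hge : θ i ^ 2 * ∑ j, y j ^ 2 ≤ ∑ j, θ j ^ 2 * y j ^ 2 := by
    rw [Finset.mul_sum]
    refine Finset.sum_le_sum fun j _ => ?_
    rcases lt_or_ge i j with hij | hij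
    · simp [hyi j hij]
    · exact mul_le_mul_of_nonneg_right (pow_le_pow_left₀ (h.nonneg i) (h.antitone hij) 2)
        (sq_nonneg _)
  have hsi := hd.pos (i.castLE hk.le)
  have hsq : s (i.castLE hk.le) ^ 2 ≤ θ i ^ 2 := pow_le_pow_left₀ hsi.le hle 2
  have hterm : ∀ l, 0 ≤ (s (i.castLE hk.le) ^ 2 - s l ^ 2) * krylovMap s c p l ^ 2 := fun l => by
    rcases lt_or_ge (l : ℕ) i with hl | hl
    · simp [hxi l hl]
    · refine mul_nonneg (sub_nonneg.2 (pow_le_pow_left₀ (hd.pos l).le (hd.anti.antitone ?_) 2))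
        (sq_nonneg _)
      rw [Fin.le_def]; simpa using hl
  have hsum : ∑ l, (s (i.castLE hk.le) ^ 2 - s l ^ 2) * krylovMap s c p l ^ 2 ≤ 0 := by
    simp_rw [sub_mul, Finset.sum_sub_distrib, ← Finset.mul_sum]
    rw [he, hn]
    have : 0 ≤ ∑ j, y j ^ 2 := Finset.sum_nonneg fun j _ => sq_nonneg _
    nlinarith
  have hall := (Finset.sum_eq_zero_iff_of_nonneg fun l _ => hterm l).1
    (le_antisymm hsum (Finset.sum_nonneg fun l _ => hterm l))
  -- Equality throughout confines the vector to coordinate `i`, so `p` has `n - 1 ≥ k` zeros.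
  have hp0 : p = 0 := by
    refine hd.eq_zero_of_card (Finset.univ.erase (i.castLE hk.le)) ?_ fun l hl => ?_
    · rw [Finset.card_erase_of_mem (Finset.mem_univ _)]
      refine (mem_degreeLT.1 hp).trans_le ?_
      simp only [Finset.card_univ, Fintype.card_fin]
      exact_mod_cast (by omega : k ≤ n - 1)
    · have hne : s (i.castLE hk.le) ^ 2 - s l ^ 2 ≠ 0 :=
        sub_ne_zero.2 fun e => (Finset.mem_erase.1 hl).1 (hd.sq_injective e).symm
      simpa only [mul_eq_zero, hne, false_or, pow_eq_zero_iff two_ne_zero] using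
        hall l (Finset.mem_univ _)
  apply hy0
  ext j
  rw [← h.sum_mul y j]
  simp_rw [← hpx, hp0]
  simp

/-- The Krylov space of dimension `i + 1` contains a nonzero vector orthogonal to the `i` leading
Ritz vectors; its Rayleigh quotient is at most `θ i ^ 2`. -/
theorem lt_of_forall_energy (h : IsRitzSystem s c g θ) (i : Fin k) (t : ℝ)
    (ht : ∀ p ∈ degreeLT ℝ (i + 1), p ≠ 0 →
      t ^ 2 * ∑ l, krylovMap s c p l ^ 2 < ∑ l, s l ^ 2 * krylovMap s c p l ^ 2) : t < θ i := by
  obtain ⟨p, hp0, hp⟩ := exists_ne_zero_forall_eq_zero (V := degreeLT ℝ (i + 1)) (ι := Fin i)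
    (fun j => (∑ l, g (j.castLE i.2.le) l • LinearMap.proj l) ∘ₗ krylovMap s c ∘ₗ
      (degreeLT ℝ (i + 1)).subtype)
    (by rw [finrank_degreeLT]; simp)
  have hpk : (p : ℝ[X]) ∈ degreeLT ℝ k := degreeLT_mono i.2 p.2
  obtain ⟨y, hy⟩ := h.exists_combination hpk
  have hyj : ∀ j, j < i → y j = 0 := fun j hj => by
    rw [← h.sum_mul y j]
    simp_rw [← hy]
    rw [← hp ⟨j, hj⟩]
    simp only [LinearMap.comp_apply, Submodule.subtype_apply, LinearMap.sum_apply,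
      LinearMap.smul_apply, LinearMap.proj_apply, smul_eq_mul]
    exact Finset.sum_congr rfl fun l _ => mul_comm _ _
  have := ht p p.2 (by simpa using hp0)
  simp_rw [hy] at this
  rw [h.sum_sq, h.sum_energy] at this
  have hle : ∑ j, θ j ^ 2 * y j ^ 2 ≤ θ i ^ 2 * ∑ j, y j ^ 2 := by
    rw [Finset.mul_sum]
    refine Finset.sum_le_sum fun j _ => ?_
    rcases lt_or_ge j i with hij | hij
    · simp [hyj j hij]
    · exact mul_le_mul_of_nonneg_right (pow_le_pow_left₀ (h.nonneg j) (h.antitone hij) 2)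
        (sq_nonneg _)
  have hlt := lt_of_mul_lt_mul_right (this.trans_le hle) (Finset.sum_nonneg fun j _ => sq_nonneg _)
  exact lt_of_pow_lt_pow_left₀ 2 (h.nonneg i) hlt

theorem lt_energy_of_lt_last (hd : IsSpectralData s c) (h : IsRitzSystem s c g θ) (hk : k ≤ n)
    (i : Fin k) (hi : (i : ℕ) + 1 = k) {t : ℝ} (ht0 : 0 ≤ t) (ht : t < θ i) {p : ℝ[X]}
    (hp : p ∈ degreeLT ℝ k) (hp0 : p ≠ 0) :
    t ^ 2 * ∑ l, krylovMap s c p l ^ 2 < ∑ l, s l ^ 2 * krylovMap s c p l ^ 2 := by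
  obtain ⟨y, hy⟩ := h.exists_combination hp
  have hpos : 0 < ∑ l, krylovMap s c p l ^ 2 := by
    refine lt_of_le_of_ne (Finset.sum_nonneg fun l _ => sq_nonneg _) fun e => hp0 ?_
    refine hd.eq_zero ((mem_degreeLT.1 hp).trans_le (by exact_mod_cast hk)) ?_
    ext l
    have := (Finset.sum_eq_zero_iff_of_nonneg fun l _ => sq_nonneg _).1 e.symm l
      (Finset.mem_univ _)
    exact (pow_eq_zero_iff two_ne_zero).1 this
  have h1 : t ^ 2 * ∑ l, krylovMap s c p l ^ 2 < θ i ^ 2 * ∑ l, krylovMap s c p l ^ 2 :=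
    mul_lt_mul_of_pos_right (pow_lt_pow_left₀ ht ht0 two_ne_zero) hpos
  refine h1.trans_le ?_
  simp_rw [hy]
  rw [h.sum_sq, h.sum_energy, Finset.mul_sum]
  refine Finset.sum_le_sum fun j _ => mul_le_mul_of_nonneg_right
    (pow_le_pow_left₀ (h.nonneg i) (h.antitone ?_) 2) (sq_nonneg _)
  rw [Fin.le_def]; omega

/-- Take `x ≠ 0` supported on coordinates up to `i` and orthogonal to the Ritz vectors before `i`,
and let `w` be its projection. With `S = diag(s)`, the triangle inequality `‖Sx‖ ≤ ‖Sw‖ + ‖S(x -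
w)‖` gives `s i ≤ θ i + γ`. -/
theorem sub_le_of_projection (h : IsRitzSystem s c g θ) (hk : k ≤ n)
    (hanti : Antitone s) (hpos : ∀ l, 0 < s l) (i : Fin k) {γ : ℝ} (hγ : 0 ≤ γ)
    (hproj : ∀ x w : Fin n → ℝ, (∀ l : Fin n, k ≤ l → x l = 0) →
      (∃ y : Fin k → ℝ, ∀ l, w l = ∑ j, y j * g j l) → (∀ j, ∑ l, (x l - w l) * g j l = 0) →
      ∑ l, s l ^ 2 * (x l - w l) ^ 2 ≤ γ ^ 2 * ∑ l, x l ^ 2) :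
    s (i.castLE hk) - θ i ≤ γ := by
  obtain ⟨x, hx0, hx⟩ := exists_ne_zero_forall_eq_zero (V := Fin n → ℝ)
    (ι := {l : Fin n // l ≠ i.castLE hk})
    (fun l => if h : (l : Fin n) < i.castLE hk then
        ∑ m, g ⟨l, (Fin.lt_def.1 h).trans i.2⟩ m • LinearMap.proj m
      else LinearMap.proj l.1)
    (by simp [Fintype.card_subtype_compl]; exact i.pos.trans_le hk)
  have hxl : ∀ l : Fin n, (i : ℕ) < l → x l = 0 := fun l hl => by
    have hne : l ≠ i.castLE hk := fun e => by simp [e] at hl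
    have hnlt : ¬ l < i.castLE hk := by rw [Fin.lt_def]; simpa using hl.le
    simpa [hnlt] using hx ⟨l, hne⟩
  set y : Fin k → ℝ := fun j => ∑ l, x l * g j l with hydef
  have hy : ∀ j, j < i → y j = 0 := fun j hj => by
    have hlt : j.castLE hk < i.castLE hk := by rw [Fin.lt_def]; simpa using hj
    have := hx ⟨j.castLE hk, hlt.ne⟩
    simp only [hlt, dif_pos] at this
    rw [hydef, ← this]
    simp [mul_comm]
  set w : Fin n → ℝ := fun l => ∑ j, y j * g j l with hw
  have horth : ∀ j, ∑ l, (x l - w l) * g j l = 0 := fun j => by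
    simp_rw [sub_mul, Finset.sum_sub_distrib]
    rw [hw, h.sum_mul y j, sub_self]
  have hbound := hproj x w (fun l hl => hxl l (i.2.trans_le hl)) ⟨y, fun l => rfl⟩ horth
  have hxpos : 0 < ∑ l, x l ^ 2 := by
    refine lt_of_le_of_ne (Finset.sum_nonneg fun l _ => sq_nonneg _) fun e => hx0 ?_
    ext l
    have := (Finset.sum_eq_zero_iff_of_nonneg fun l _ => sq_nonneg _).1 e.symm l
      (Finset.mem_univ _)
    exact (pow_eq_zero_iff two_ne_zero).1 this
  have hyx : ∑ j, y j ^ 2 ≤ ∑ l, x l ^ 2 := by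
    have hxw : ∑ l, x l * w l = ∑ j, y j ^ 2 := by
      simp_rw [hw, Finset.mul_sum]
      rw [Finset.sum_comm]
      refine Finset.sum_congr rfl fun j _ => ?_
      rw [sq]
      nth_rw 3 [hydef]
      rw [Finset.mul_sum]
      exact Finset.sum_congr rfl fun l _ => by ring
    have hww : ∑ l, w l ^ 2 = ∑ j, y j ^ 2 := h.sum_sq y
    have : 0 ≤ ∑ l, (x l - w l) ^ 2 := Finset.sum_nonneg fun l _ => sq_nonneg _
    have e : ∑ l, (x l - w l) ^ 2 = ∑ l, x l ^ 2 - 2 * ∑ l, x l * w l + ∑ l, w l ^ 2 := by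
      rw [Finset.mul_sum, ← Finset.sum_sub_distrib, ← Finset.sum_add_distrib]
      exact Finset.sum_congr rfl fun l _ => by ring
    rw [e, hxw, hww] at this
    linarith
  have hwE : ∑ l, s l ^ 2 * w l ^ 2 ≤ θ i ^ 2 * ∑ l, x l ^ 2 := by
    rw [hw, h.sum_energy y]
    refine le_trans ?_ (mul_le_mul_of_nonneg_left hyx (sq_nonneg _))
    rw [Finset.mul_sum]
    refine Finset.sum_le_sum fun j _ => ?_
    rcases lt_or_ge j i with hij | hij
    · simp [hy j hij]
    · exact mul_le_mul_of_nonneg_right (pow_le_pow_left₀ (h.nonneg j) (h.antitone hij) 2)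
        (sq_nonneg _)
  have hxE : s (i.castLE hk) ^ 2 * ∑ l, x l ^ 2 ≤ ∑ l, s l ^ 2 * x l ^ 2 := by
    rw [Finset.mul_sum]
    refine Finset.sum_le_sum fun l _ => ?_
    rcases lt_or_ge (i : ℕ) l with hl | hl
    · simp [hxl l hl]
    · exact mul_le_mul_of_nonneg_right
        (pow_le_pow_left₀ (hpos _).le (hanti (by rw [Fin.le_def]; simpa using hl)) 2)
        (sq_nonneg _)
  -- The triangle inequality is carried out in squared form, with Cauchy–Schwarz for the cross term.
  have hcs := Finset.sum_mul_sq_le_sq_mul_sq Finset.univ (fun l => s l * w l)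
    fun l => s l * (x l - w l)
  simp_rw [mul_pow] at hcs
  have hsplit : ∑ l, s l ^ 2 * x l ^ 2 = ∑ l, s l ^ 2 * w l ^ 2
      + 2 * (∑ l, s l * w l * (s l * (x l - w l))) + ∑ l, s l ^ 2 * (x l - w l) ^ 2 := by
    rw [Finset.mul_sum, ← Finset.sum_add_distrib, ← Finset.sum_add_distrib]
    exact Finset.sum_congr rfl fun l _ => by ring
  set N := ∑ l, x l ^ 2
  have hcross : ∑ l, s l * w l * (s l * (x l - w l)) ≤ θ i * γ * N := by
    refine abs_le_of_sq_le_sq' ?_ (by have := h.nonneg i; positivity) |>.2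
    calc _ ≤ _ := hcs
      _ ≤ (θ i ^ 2 * N) * (γ ^ 2 * N) := mul_le_mul hwE hbound
          (Finset.sum_nonneg fun l _ => by positivity) (by positivity)
      _ = _ := by ring
  have hfinal : s (i.castLE hk) ^ 2 * N ≤ (θ i + γ) ^ 2 * N := by
    nlinarith
  have := abs_le_of_sq_le_sq' (le_of_mul_le_mul_right hfinal hxpos)
    (add_nonneg (h.nonneg i) hγ) |>.2
  linarith

end IsRitzSystem

end Krylov

/-! ### The Krylov space as a graph, and the error bound -/

section Delta

variable {m n : ℕ} (U : Matrix (Fin m) (Fin m) ℝ) (σ : ℕ → ℝ) (b : EuclideanSpace ℝ (Fin m))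

/-- The singular values, indexed from `0`. -/
def spectrumFin (n : ℕ) (σ : ℕ → ℝ) (l : Fin n) : ℝ := σ (l + 1)

/-- The coefficients `u_iᵀ b`, indexed from `0`. -/
def coeffFin (n : ℕ) (U : Matrix (Fin m) (Fin m) ℝ) (b : EuclideanSpace ℝ (Fin m)) (l : Fin n) : ℝ :=
  leftCoeff U b (l + 1)

variable {U σ b}

theorem sum_head_eq_sum_range (k : ℕ) (hk : k ≤ n) (f : ℕ → ℝ) :
    ∑ j : {j : Fin n // isHead k j}, f (j : Fin n) = ∑ i ∈ Finset.range k, f i := by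
  rw [← Fin.sum_univ_eq_sum_range]
  exact Fintype.sum_equiv
    ⟨fun j => ⟨j.1, j.2⟩, fun i => ⟨i.castLE hk, i.2⟩, fun _ => rfl, fun _ => rfl⟩ _ _ fun _ => rfl

theorem krylovD_krylovT_mulVec (k : ℕ) (hk : k ≤ n) (P : Fin n → Prop) [DecidablePred P]
    {p : ℝ[X]} (hp : p ∈ degreeLT ℝ k) (l : {j : Fin n // P j}) :
    ((krylovD n U σ b).toBlock P P *ᵥ ((krylovT n σ).toBlock P (isHead k) *ᵥ
      fun j => p.coeff (j : Fin n))) l = krylovMap (spectrumFin n σ) (coeffFin n U b) p l := by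
  rw [krylovD, Matrix.toBlock_diagonal_self, Matrix.mulVec_diagonal, krylovMap_apply]
  simp only [spectrumFin, coeffFin]
  congr 1
  have hsum : p.eval (σ ((l : Fin n) + 1) ^ 2)
      = ∑ i ∈ Finset.range k, p.coeff i * (σ ((l : Fin n) + 1) ^ 2) ^ i := by
    by_cases h0 : p = 0
    · simp [h0]
    · exact eval_eq_sum_range' ((natDegree_lt_iff_degree_lt h0).2 (mem_degreeLT.1 hp)) _
  rw [hsum, ← sum_head_eq_sum_range k hk fun i => p.coeff i * (σ ((l : Fin n) + 1) ^ 2) ^ i]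
  simp only [Matrix.mulVec, dotProduct, Matrix.toBlock_apply, krylovT, Matrix.vandermonde_apply]
  exact Finset.sum_congr rfl fun j _ => mul_comm _ _

variable (hd : IsSpectralData (spectrumFin n σ) (coeffFin n U b))
include hd

theorem isUnit_det_krylovD_head (k : ℕ) :
    IsUnit ((krylovD n U σ b).toBlock (isHead k) (isHead k)).det := by
  rw [krylovD, Matrix.toBlock_diagonal_self, Matrix.det_diagonal, isUnit_iff_ne_zero,
    Finset.prod_ne_zero_iff]
  exact fun j _ => mul_ne_zero (hd.pos j).ne' (hd.coeff_ne j)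

theorem isUnit_det_krylovT_head (k : ℕ) (hk : k ≤ n) :
    IsUnit ((krylovT n σ).toBlock (isHead k) (isHead k)).det := by
  let f : Fin k ≃ {j : Fin n // isHead k j} :=
    ⟨fun i => ⟨i.castLE hk, i.2⟩, fun j => ⟨j.1, j.2⟩, fun _ => rfl, fun _ => rfl⟩
  rw [← Matrix.det_submatrix_equiv_self f]
  have : ((krylovT n σ).toBlock (isHead k) (isHead k)).submatrix f f
      = Matrix.vandermonde fun i : Fin k => σ (i + 1) ^ 2 := rfl
  rw [this, isUnit_iff_ne_zero, Matrix.det_vandermonde_ne_zero_iff]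
  intro i j hij
  exact Fin.castLE_injective hk (hd.sq_injective hij)

/-- `D₁T₁` and `D₂T₂` send the coefficients of `p` to the head and the tail of its Krylov vector, so
`Δ = (D₂T₂)(D₁T₁)⁻¹` carries head to tail. -/
theorem krylovDelta_mulVec_krylovMap (k : ℕ) (hk : k ≤ n) {p : ℝ[X]} (hp : p ∈ degreeLT ℝ k) :
    (krylovDelta n U σ b k *ᵥ fun j : {j : Fin n // isHead k j} =>
      krylovMap (spectrumFin n σ) (coeffFin n U b) p j)
      = fun l : {j : Fin n // isTail k j} =>
        krylovMap (spectrumFin n σ) (coeffFin n U b) p l := by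
  have h1 := funext fun l => krylovD_krylovT_mulVec (U := U) (σ := σ) (b := b) k hk (isHead k) hp l
  have h2 := funext fun l => krylovD_krylovT_mulVec (U := U) (σ := σ) (b := b) k hk (isTail k) hp l
  rw [← h1, ← h2, krylovDelta]
  have hD := isUnit_det_krylovD_head hd k
  have hT := isUnit_det_krylovT_head hd k hk
  simp only [Matrix.mulVec_mulVec]
  congr 1
  rw [Matrix.mul_assoc, Matrix.mul_assoc, Matrix.nonsing_inv_mul_cancel_left _ _ hD,
    Matrix.nonsing_inv_mul _ hT, Matrix.mul_one]

theorem exists_krylovMap_head_eq (k : ℕ) (hk : k ≤ n) (y : {j : Fin n // isHead k j} → ℝ) :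
    ∃ p ∈ degreeLT ℝ k, ∀ j : {j : Fin n // isHead k j},
      krylovMap (spectrumFin n σ) (coeffFin n U b) p j = y j := by
  have hD := isUnit_det_krylovD_head hd k
  have hT := isUnit_det_krylovT_head hd k hk
  set a := ((krylovT n σ).toBlock (isHead k) (isHead k))⁻¹ *ᵥ
    (((krylovD n U σ b).toBlock (isHead k) (isHead k))⁻¹ *ᵥ y) with ha
  set p : ℝ[X] := ∑ j : {j : Fin n // isHead k j}, monomial ((j : Fin n) : ℕ) (a j) with hpdef
  have hp : p ∈ degreeLT ℝ k := Submodule.sum_mem _ fun j _ =>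
    mem_degreeLT.2 ((degree_monomial_le _ _).trans_lt (Nat.cast_lt.2 j.2))
  have hcoeff : (fun j : {j : Fin n // isHead k j} => p.coeff (j : Fin n)) = a := by
    ext j
    rw [hpdef, finsetSum_coeff, Finset.sum_eq_single j]
    · simp
    · intro i _ hij
      rw [coeff_monomial, if_neg fun e => hij (Subtype.ext (Fin.ext e))]
    · simp
  refine ⟨p, hp, fun j => ?_⟩
  rw [← krylovD_krylovT_mulVec k hk (isHead k) hp, hcoeff, ha,
    Matrix.mulVec_mulVec _ ((krylovT n σ).toBlock (isHead k) (isHead k)),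
    Matrix.mul_nonsing_inv _ hT, Matrix.one_mulVec, Matrix.mulVec_mulVec,
    Matrix.mul_nonsing_inv _ hD, Matrix.one_mulVec]

omit hd in
theorem isUnit_det_one_add_transpose_mul_self {ι κ : Type*} [Fintype ι] [Fintype κ]
    [DecidableEq κ] (M : Matrix ι κ ℝ) : IsUnit (1 + Mᵀ * M).det := by
  have h : (1 + Mᵀ * M).PosDef := Matrix.PosDef.one.add_posSemidef (by
    simpa using Matrix.posSemidef_conjTranspose_mul_self M)
  exact isUnit_iff_ne_zero.2 h.det_pos.ne'

omit hd in
open scoped Matrix.Norms.L2Operator in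
theorem sum_mulVec_sq_le {ι : Type*} [Fintype ι] [DecidableEq ι] (M : Matrix ι ι ℝ) (x : ι → ℝ) :
    ∑ i, (M *ᵥ x) i ^ 2 ≤ ‖M‖ ^ 2 * ∑ i, x i ^ 2 := by
  have := M.l2_opNorm_mulVec (WithLp.toLp 2 x)
  have h2 := pow_le_pow_left₀ (norm_nonneg _) this 2
  rw [mul_pow, EuclideanSpace.norm_sq_eq, EuclideanSpace.norm_sq_eq] at h2
  simpa using h2

open scoped Matrix.Norms.L2Operator in
theorem projection_energy_le {k : ℕ} (hk : k < n) {g : Fin k → Fin n → ℝ} {θ : Fin k → ℝ}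
    (h : IsRitzSystem (spectrumFin n σ) (coeffFin n U b) g θ) (x w : Fin n → ℝ)
    (hx : ∀ l : Fin n, k ≤ l → x l = 0) (hw : ∃ y : Fin k → ℝ, ∀ l, w l = ∑ j, y j * g j l)
    (horth : ∀ j, ∑ l, (x l - w l) * g j l = 0) :
    ∑ l, spectrumFin n σ l ^ 2 * (x l - w l) ^ 2
      ≤ (epsilonK n U σ b k ^ 2 + σ (k + 1) ^ 2) * ∑ l, x l ^ 2 := by
  have hcomb : ∀ y : Fin k → ℝ, ∑ l, (x l - w l) * ∑ j, y j * g j l = 0 := fun y => by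
    simp_rw [Finset.mul_sum]
    rw [Finset.sum_comm]
    refine Finset.sum_eq_zero fun j _ => ?_
    rw [← mul_zero (y j), ← horth j, Finset.mul_sum]
    exact Finset.sum_congr rfl fun l _ => by ring
  have hperp : ∀ p ∈ degreeLT ℝ k,
      ∑ l, (x l - w l) * krylovMap (spectrumFin n σ) (coeffFin n U b) p l = 0 := fun p hp => by
    obtain ⟨y, hy⟩ := h.exists_combination hp
    simp_rw [hy]
    exact hcomb y
  obtain ⟨y, hy⟩ := hw
  obtain ⟨p, hp, hpw⟩ := h.combination_mem y
  simp_rw [← hy] at hpw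
  have hle : ∑ l, (x l - w l) ^ 2 ≤ ∑ l, x l ^ 2 := by
    have e : ∑ l, x l ^ 2 = ∑ l, (x l - w l) ^ 2 + 2 * ∑ l, (x l - w l) * w l + ∑ l, w l ^ 2 := by
      rw [Finset.mul_sum, ← Finset.sum_add_distrib, ← Finset.sum_add_distrib]
      exact Finset.sum_congr rfl fun l _ => by ring
    have h0 : ∑ l, (x l - w l) * w l = 0 := by simp_rw [hy] at hcomb ⊢; exact hcomb y
    rw [e, h0]
    have : 0 ≤ ∑ l, w l ^ 2 := Finset.sum_nonneg fun l _ => sq_nonneg _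
    linarith
  set Δ := krylovDelta n U σ b k with hΔ
  set x₁ : {j : Fin n // isHead k j} → ℝ := fun j => x j with hx₁
  set w₁ : {j : Fin n // isHead k j} → ℝ := fun j => w j with hw₁
  have hw₂ : Δ *ᵥ w₁ = fun l : {j : Fin n // isTail k j} => w l := by
    have := krylovDelta_mulVec_krylovMap hd k hk.le hp
    simpa only [hpw] using this
  -- Normal equations: the residual is tested against the graph vectors `(e, Δe)`, where `x` has no
  -- tail.
  have hnormal : x₁ = (1 + Δᵀ * Δ) *ᵥ w₁ := by
    have hz : x₁ - (1 + Δᵀ * Δ) *ᵥ w₁ = 0 := by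
      refine dotProduct_eq_zero _ fun e => ?_
      obtain ⟨q, hq, hqe⟩ := exists_krylovMap_head_eq hd k hk.le e
      have hq₂ := krylovDelta_mulVec_krylovMap hd k hk.le hq
      simp only [hqe] at hq₂
      have hs := hperp q hq
      rw [← Fintype.sum_subtype_add_sum_subtype (isHead k)] at hs
      have e1 : ∑ i : {j : Fin n // isHead k j}, (x i - w i)
          * krylovMap (spectrumFin n σ) (coeffFin n U b) q i = (x₁ - w₁) ⬝ᵥ e :=
        Finset.sum_congr rfl fun j _ => by rw [hqe]; rfl
      have e2 : ∑ i : {j : Fin n // isTail k j}, (x i - w i)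
          * krylovMap (spectrumFin n σ) (coeffFin n U b) q i = -((Δ *ᵥ w₁) ⬝ᵥ (Δ *ᵥ e)) := by
        rw [hw₂, hq₂, ← neg_dotProduct]
        refine Finset.sum_congr rfl fun j _ => ?_
        rw [hx j (not_lt.1 j.2), zero_sub]; rfl
      have e3 : (Δ *ᵥ w₁) ⬝ᵥ (Δ *ᵥ e) = ((Δᵀ * Δ) *ᵥ w₁) ⬝ᵥ e := by
        rw [Matrix.dotProduct_mulVec, ← Matrix.mulVec_transpose, Matrix.mulVec_mulVec]
      rw [e1, e2, e3] at hs
      rw [Matrix.add_mulVec, Matrix.one_mulVec, sub_dotProduct, add_dotProduct]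
      rw [sub_dotProduct] at hs
      linarith
    exact sub_eq_zero.1 hz
  have hunit := isUnit_det_one_add_transpose_mul_self Δ
  have hdiff : ((1 + Δᵀ * Δ)⁻¹ * (Δᵀ * Δ)) *ᵥ x₁ = x₁ - w₁ := by
    have hcomm : (Δᵀ * Δ) * (1 + Δᵀ * Δ) = (1 + Δᵀ * Δ) * (Δᵀ * Δ) := by
      rw [mul_add, add_mul, mul_one, one_mul]
    rw [hnormal, Matrix.mulVec_mulVec, Matrix.mul_assoc, hcomm,
      Matrix.nonsing_inv_mul_cancel_left _ _ hunit, Matrix.add_mulVec, Matrix.one_mulVec,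
      add_sub_cancel_left]
  have hhead : ∑ j : {j : Fin n // isHead k j}, spectrumFin n σ j ^ 2 * (x j - w j) ^ 2
      ≤ epsilonK n U σ b k ^ 2 * ∑ l, x l ^ 2 := by
    have e1 : ∑ j : {j : Fin n // isHead k j}, spectrumFin n σ j ^ 2 * (x j - w j) ^ 2
        = ∑ j, ((headSigma n σ k * (1 + Δᵀ * Δ)⁻¹ * (Δᵀ * Δ)) *ᵥ x₁) j ^ 2 := by
      refine Finset.sum_congr rfl fun j _ => ?_
      rw [Matrix.mul_assoc, ← Matrix.mulVec_mulVec, hdiff, headSigma, Matrix.mulVec_diagonal,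
        mul_pow]
      rfl
    have e2 : ∑ j, x₁ j ^ 2 ≤ ∑ l, x l ^ 2 := by
      rw [← Fintype.sum_subtype_add_sum_subtype (isHead k) fun l => x l ^ 2]
      exact le_add_of_nonneg_right (Finset.sum_nonneg fun l _ => sq_nonneg _)
    -- Only the first of the two terms of `ε_k²` is needed.
    have e3 : ‖headSigma n σ k * (1 + Δᵀ * Δ)⁻¹ * (Δᵀ * Δ)‖ ^ 2 ≤ epsilonK n U σ b k ^ 2 := by
      rw [epsilonK, Real.sq_sqrt (by positivity), ← hΔ]
      exact le_add_of_nonneg_right (sq_nonneg _)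
    rw [e1]
    exact (sum_mulVec_sq_le _ _).trans (mul_le_mul e3 e2
      (Finset.sum_nonneg fun l _ => sq_nonneg _) (sq_nonneg _))
  -- On the tail the singular values are at most `σ (k + 1)`, and a projection residual is no longer
  -- than `x`.
  have htail : ∑ j : {j : Fin n // isTail k j}, spectrumFin n σ j ^ 2 * (x j - w j) ^ 2
      ≤ σ (k + 1) ^ 2 * ∑ l, x l ^ 2 := by
    refine le_trans ?_ (mul_le_mul_of_nonneg_left hle (sq_nonneg _))
    rw [← Fintype.sum_subtype_add_sum_subtype (isHead k) fun l => (x l - w l) ^ 2, mul_add]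
    refine le_add_of_nonneg_of_le (mul_nonneg (sq_nonneg _)
      (Finset.sum_nonneg fun l _ => sq_nonneg _)) ?_
    rw [Finset.mul_sum]
    refine Finset.sum_le_sum fun j _ => mul_le_mul_of_nonneg_right
      (pow_le_pow_left₀ (hd.pos j).le ?_ 2) (sq_nonneg _)
    exact hd.anti.antitone (a := ⟨k, hk⟩) (by rw [Fin.le_def]; exact not_lt.1 j.2)
  rw [← Fintype.sum_subtype_add_sum_subtype (isHead k)]
  linarith

theorem singularValue_sub_ritz_le {k : ℕ} (hk : k < n) {g : Fin k → Fin n → ℝ} {θ : Fin k → ℝ}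
    (h : IsRitzSystem (spectrumFin n σ) (coeffFin n U b) g θ) (i : Fin k) :
    σ (i + 1) - θ i ≤ √(1 + etaK n U σ b k ^ 2) * σ (k + 1) := by
  have hσ : 0 < σ (k + 1) := hd.pos ⟨k, hk⟩
  refine h.sub_le_of_projection hk.le hd.anti.antitone hd.pos i (by positivity)
    fun x w hx hw horth => ?_
  refine (projection_energy_le hd hk h x w hx hw horth).trans_eq ?_
  rw [mul_pow, Real.sq_sqrt (by positivity), etaK]
  field_simp
  ring

end Delta

/-! ### Polynomials on geometric nodes -/

section Geometric

variable {a q : ℝ}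

/-- A polynomial of degree at most `k` is controlled on `[0, a q ^ k]` by its values at the
geometrically decreasing nodes `a, a q, …, a q ^ k`. -/
theorem abs_eval_le_of_geometric_nodes (ha : 0 < a) (hq0 : 0 < q) (hq : q ≤ 1 / 5) (k : ℕ)
    (p : ℝ[X]) (hp : p ∈ degreeLT ℝ (k + 1)) (N : ℝ)
    (hN : ∀ i ≤ k, a * q ^ i * |p.eval (a * q ^ i)| ≤ N) (x : ℝ) (hx0 : 0 ≤ x)
    (hx : x ≤ a * q ^ k) : a * q ^ k * |p.eval x| ≤ 2 * N := by
  induction k generalizing p N with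
  | zero =>
    have hpC : p = C (p.coeff 0) := eq_C_of_degree_le_zero (by
      have := mem_degreeLT.1 hp
      exact Nat.WithBot.lt_one_iff_le_zero.1 (by simpa using this))
    have h0 := hN 0 le_rfl
    rw [hpC, eval_C] at h0 ⊢
    have : 0 ≤ a * q ^ 0 * |p.coeff 0| := by positivity
    linarith
  | succ k ih =>
    set y := a * q ^ (k + 1) with hy
    have hypos : 0 < y := by positivity
    have hyk : y = q * (a * q ^ k) := by rw [hy, pow_succ]; ring
    have hkpos : 0 < a * q ^ k := by positivity
    -- Dividing out the smallest node `y` leaves degree at most `k` and the nodes `z ≥ y / q`, where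
    -- `z - y ≥ (1 - q) z`; hence the bound `(1 + q) / (1 - q) * N / y` for `r`.
    set r := p /ₘ (X - C y) with hr
    have hpr : ∀ z, p.eval z = p.eval y + (z - y) * r.eval z := fun z => by
      have := congrArg (eval z) (modByMonic_add_div p (X - C y))
      rw [modByMonic_X_sub_C_eq_C_eval] at this
      simpa using this.symm
    have hrdeg : r ∈ degreeLT ℝ (k + 1) := by
      rw [mem_degreeLT]
      by_cases hr0 : r = 0
      · simp [hr0]
      · by_cases hp0 : p = 0
        · simp [hr, hp0]
        have h1 := natDegree_divByMonic p (monic_X_sub_C y)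
        rw [natDegree_X_sub_C, ← hr] at h1
        have h2 := (natDegree_lt_iff_degree_lt hp0).2 (mem_degreeLT.1 hp)
        rw [← natDegree_lt_iff_degree_lt hr0]
        omega
    have hNy : y * |p.eval y| ≤ N := hN (k + 1) le_rfl
    have hN0 : 0 ≤ N := le_trans (by positivity) hNy
    have hIH := ih r hrdeg ((1 + q) / (1 - q) * N / y) (fun i hi => by
      set z := a * q ^ i with hz
      have hzk : a * q ^ k ≤ z :=
        mul_le_mul_of_nonneg_left (pow_le_pow_of_le_one hq0.le (by linarith) hi) ha.le
      have hNz : z * |p.eval z| ≤ N := hN i (by omega)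
      have hzpos : 0 < z := by positivity
      have hyz : y ≤ q * z := by rw [hyk]; exact mul_le_mul_of_nonneg_left hzk hq0.le
      have hdiff : (1 - q) * z ≤ z - y := by linarith
      have habs : (z - y) * |r.eval z| ≤ |p.eval z| + |p.eval y| := by
        have hnn : 0 ≤ z - y := le_trans (mul_nonneg (by linarith) hzpos.le) hdiff
        have : (z - y) * r.eval z = p.eval z - p.eval y := by rw [hpr z]; ring
        rw [show (z - y) * |r.eval z| = |(z - y) * r.eval z| by rw [abs_mul, abs_of_nonneg hnn], this]
        exact abs_sub _ _
      have hpz : y * |p.eval z| ≤ q * N := by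
        calc y * |p.eval z| ≤ q * z * |p.eval z| :=
              mul_le_mul_of_nonneg_right hyz (abs_nonneg _)
          _ = q * (z * |p.eval z|) := by ring
          _ ≤ q * N := mul_le_mul_of_nonneg_left hNz hq0.le
      have h3 : (1 - q) * z * |r.eval z| ≤ |p.eval z| + |p.eval y| :=
        (mul_le_mul_of_nonneg_right hdiff (abs_nonneg _)).trans habs
      have hq1 : 0 < 1 - q := by linarith
      rw [le_div_iff₀ hypos, div_mul_eq_mul_div, le_div_iff₀ hq1]
      calc z * |r.eval z| * y * (1 - q) = y * ((1 - q) * z * |r.eval z|) := by ring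
        _ ≤ y * (|p.eval z| + |p.eval y|) := mul_le_mul_of_nonneg_left h3 hypos.le
        _ ≤ (1 + q) * N := by linarith) (hx.trans (by rw [hyk]; nlinarith))
    have hxy : |x - y| ≤ y := abs_le.2 ⟨by linarith, by linarith⟩
    have hq1 : 0 < 1 - q := by linarith
    calc y * |p.eval x| ≤ y * (|p.eval y| + y * |r.eval x|) := by
          refine mul_le_mul_of_nonneg_left ?_ hypos.le
          rw [hpr x]
          refine (abs_add_le _ _).trans (add_le_add le_rfl ?_)
          rw [abs_mul]
          exact mul_le_mul_of_nonneg_right hxy (abs_nonneg _)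
      _ = y * |p.eval y| + y * q * (a * q ^ k * |r.eval x|) := by rw [hyk]; ring
      _ ≤ N + y * q * (2 * ((1 + q) / (1 - q) * N / y)) :=
          add_le_add hNy (mul_le_mul_of_nonneg_left hIH (by positivity))
      _ = N + 2 * q * (1 + q) / (1 - q) * N := by field_simp
      -- The factor `2` survives the induction because `2q(1 + q) ≤ 1 - q` for `q ≤ 1/5`.
      _ ≤ N + 1 * N := by
          refine add_le_add le_rfl (mul_le_mul_of_nonneg_right ?_ hN0)
          rw [div_le_one hq1]
          nlinarith
      _ = 2 * N := by ring

theorem sum_geometric_le (hq0 : 0 < q) (hq : q < 1) (d : ℕ) :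
    ∑ l ∈ Finset.range d, q ^ l ≤ 1 / (1 - q) := by
  rw [geom_sum_eq hq.ne, ← neg_div_neg_eq]
  refine div_le_div₀ zero_le_one ?_ (by linarith) (by linarith)
  have : 0 < q ^ d := pow_pos hq0 d
  linarith

/-- Let `N` be the largest node-weighted value of `|p|` on the first `k + 1` nodes; it is positive
since `p` has degree at most `k`. The node attaining it contributes at least `(1 - q) e N²`. The
remaining nodes lose at most `4q² e N² ∑ q^l ≤ 4q² e N² / (1 - q)`, and `4q² < (1 - q)²`. -/
theorem geometric_energy_pos (ha : 0 < a) (hq0 : 0 < q) (hq : q ≤ 1 / 5) (k d : ℕ) (c : ℕ → ℝ)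
    {e : ℝ} (he : 0 < e) (hhead : ∀ l < k + 1, e ≤ c l ^ 2)
    (htail : ∀ l, k + 1 ≤ l → l < k + 1 + d → c l ^ 2 ≤ e) (p : ℝ[X])
    (hp : p ∈ degreeLT ℝ (k + 1)) (hp0 : p ≠ 0) :
    0 < ∑ l ∈ Finset.range (k + 1 + d), (a * q ^ l - a * q ^ (k + 1)) *
      (a * q ^ l * c l ^ 2 * p.eval (a * q ^ l) ^ 2) := by
  obtain ⟨i, hi, hmax⟩ := Finset.exists_max_image (Finset.range (k + 1))
    (fun l => a * q ^ l * |p.eval (a * q ^ l)|) ⟨0, by simp⟩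
  have hq1 : 0 < 1 - q := by linarith
  set N := a * q ^ i * |p.eval (a * q ^ i)| with hN
  have hbound : ∀ l ≤ k, a * q ^ l * |p.eval (a * q ^ l)| ≤ N := fun l hl =>
    hmax l (Finset.mem_range.2 (by omega))
  have hNpos : 0 < N := by
    refine lt_of_le_of_ne (by positivity) fun h0 => hp0 ?_
    refine eq_zero_of_degree_lt_of_eval_index_eq_zero (Finset.range (k + 1))
      (v := fun l => a * q ^ l) ?_ (by simpa using mem_degreeLT.1 hp) fun l hl => ?_
    · intro l _ l' _ hll
      exact pow_right_injective₀ hq0 (by linarith) (mul_left_cancel₀ ha.ne' hll)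
    · have h1 := hbound l (Nat.lt_succ_iff.1 (Finset.mem_range.1 hl))
      rw [← h0] at h1
      have h2 : 0 < a * q ^ l := by positivity
      exact abs_eq_zero.1 (le_antisymm (nonpos_of_mul_nonpos_right h1 h2) (abs_nonneg _))
  have hterm : ∀ l ∈ Finset.range (k + 1), 0 ≤ (a * q ^ l - a * q ^ (k + 1)) *
      (a * q ^ l * c l ^ 2 * p.eval (a * q ^ l) ^ 2) := fun l hl =>
    mul_nonneg (sub_nonneg.2 (mul_le_mul_of_nonneg_left (pow_le_pow_of_le_one hq0.le (by linarith)
      (Finset.mem_range.1 hl).le) ha.le)) (by positivity)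
  have hsum1 : (1 - q) * e * N ^ 2 ≤ ∑ l ∈ Finset.range (k + 1),
      (a * q ^ l - a * q ^ (k + 1)) * (a * q ^ l * c l ^ 2 * p.eval (a * q ^ l) ^ 2) := by
    refine le_trans ?_ (Finset.single_le_sum hterm hi)
    have h1 : (1 - q) * (a * q ^ i) ≤ a * q ^ i - a * q ^ (k + 1) := by
      have : a * q ^ (k + 1) ≤ a * q ^ (i + 1) := mul_le_mul_of_nonneg_left
        (pow_le_pow_of_le_one hq0.le (by linarith) (Finset.mem_range.1 hi)) ha.le
      rw [pow_succ q i] at this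
      linarith
    have hnn := (mul_nonneg hq1.le (by positivity)).trans h1
    have hei := hhead i (Finset.mem_range.1 hi)
    calc (1 - q) * e * N ^ 2
        = (1 - q) * (a * q ^ i) * (a * q ^ i * e * p.eval (a * q ^ i) ^ 2) := by
          rw [hN, mul_pow, sq_abs]; ring
      _ ≤ _ := by gcongr
  have hsum2 : -(∑ l ∈ Finset.range d, q ^ l) * (4 * q ^ 2 * e * N ^ 2) ≤
      ∑ l ∈ Finset.range d, (a * q ^ (k + 1 + l) - a * q ^ (k + 1)) *
        (a * q ^ (k + 1 + l) * c (k + 1 + l) ^ 2 * p.eval (a * q ^ (k + 1 + l)) ^ 2) := by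
    rw [neg_mul, Finset.sum_mul, ← Finset.sum_neg_distrib]
    refine Finset.sum_le_sum fun l hl => ?_
    have hx : a * q ^ (k + 1 + l) ≤ a * q ^ k := mul_le_mul_of_nonneg_left
      (pow_le_pow_of_le_one hq0.le (by linarith) (by omega)) ha.le
    have hpx := abs_eval_le_of_geometric_nodes ha hq0 hq k p hp N hbound _ (by positivity) hx
    have hc := htail (k + 1 + l) (by omega) (by have := Finset.mem_range.1 hl; omega)
    set v := p.eval (a * q ^ (k + 1 + l)) with hv
    have hpx2 : (a * q ^ k) ^ 2 * v ^ 2 ≤ 4 * N ^ 2 := by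
      have := pow_le_pow_left₀ (by positivity) hpx 2
      rw [mul_pow, sq_abs] at this
      linarith
    have h1 : a * q ^ (k + 1) * (a * q ^ (k + 1 + l) * c (k + 1 + l) ^ 2 * v ^ 2)
        ≤ q ^ l * (4 * q ^ 2 * e * N ^ 2) := by
      calc a * q ^ (k + 1) * (a * q ^ (k + 1 + l) * c (k + 1 + l) ^ 2 * v ^ 2)
          = q ^ l * (q ^ 2 * (c (k + 1 + l) ^ 2) * ((a * q ^ k) ^ 2 * v ^ 2)) := by
            rw [pow_add, pow_succ]; ring
        _ ≤ q ^ l * (q ^ 2 * e * (4 * N ^ 2)) := by gcongr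
        _ = _ := by ring
    have h2 : 0 ≤ a * q ^ (k + 1 + l) * (a * q ^ (k + 1 + l) * c (k + 1 + l) ^ 2 * v ^ 2) := by
      positivity
    rw [sub_mul]
    linarith
  rw [Finset.sum_range_add]
  have hg := sum_geometric_le hq0 (by linarith) d
  have heN : 0 < e * N ^ 2 := by positivity
  have h3 : (∑ l ∈ Finset.range d, q ^ l) * (4 * q ^ 2) < 1 - q := by
    calc (∑ l ∈ Finset.range d, q ^ l) * (4 * q ^ 2) ≤ 1 / (1 - q) * (4 * q ^ 2) := by gcongr
      _ < 1 - q := by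
        rw [div_mul_eq_mul_div, div_lt_iff₀ hq1]
        nlinarith
  have h4 := mul_lt_mul_of_pos_right h3 heN
  linarith

end Geometric

/-! ### Energy bound for a geometric spectrum -/

section Models

variable {n : ℕ} {s c : Fin n → ℝ}

/-- On the `k`-th Krylov space of a geometrically decaying spectrum, the energy exceeds the
`(k + 1)`-st squared singular value. -/
theorem IsSpectralData.lt_energy_of_geometric (hd : IsSpectralData s c)
    (hc : ∀ i j : Fin n, i ≤ j → |c j| ≤ |c i|) {a q : ℝ} (ha : 0 < a) (hq0 : 0 < q)
    (hq : q ≤ 1 / 5) (hs : ∀ l : Fin n, s l ^ 2 = a * q ^ (l : ℕ)) {k : ℕ} (hk : k + 1 < n)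
    {p : ℝ[X]} (hp : p ∈ degreeLT ℝ (k + 1)) (hp0 : p ≠ 0) :
    s ⟨k + 1, hk⟩ ^ 2 * ∑ l, krylovMap s c p l ^ 2 < ∑ l, s l ^ 2 * krylovMap s c p l ^ 2 := by
  obtain ⟨d, hd'⟩ : ∃ d, n = k + 1 + d := ⟨n - (k + 1), by omega⟩
  set c' : ℕ → ℝ := fun l => if h : l < n then c ⟨l, h⟩ else 0 with hc'
  have hcv : ∀ l (h : l < n), c' l = c ⟨l, h⟩ := fun l h => by simp [hc', h]
  have he : 0 < c' (k + 1) ^ 2 := by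
    rw [hcv _ hk]; exact sq_pos_of_ne_zero (hd.coeff_ne _)
  have key := geometric_energy_pos ha hq0 hq k d c' he
    (fun l hl => by
      rw [hcv _ hk, hcv l (by omega)]
      exact sq_le_sq.2 (hc _ _ (by rw [Fin.le_def]; exact hl.le)))
    (fun l hl hl' => by
      rw [hcv _ hk, hcv l (by omega)]
      exact sq_le_sq.2 (hc _ _ (by rw [Fin.le_def]; exact hl))) p hp hp0
  rw [← hd', ← Fin.sum_univ_eq_sum_range (fun l => (a * q ^ l - a * q ^ (k + 1)) *
      (a * q ^ l * c' l ^ 2 * p.eval (a * q ^ l) ^ 2)) n] at key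
  rw [Finset.mul_sum, ← sub_pos, ← Finset.sum_sub_distrib]
  refine key.trans_eq (Finset.sum_congr rfl fun l _ => ?_)
  rw [krylovMap_apply, hcv l l.2, mul_pow, mul_pow, hs ⟨k + 1, hk⟩, hs l]
  ring

end Models

/-! ### Orthonormality of the Lanczos vectors -/

section Bidiagonalization

open scoped InnerProductSpace

/-- Vectors generated by the coupled two-term recurrences of Lanczos bidiagonalization are
orthonormal as long as no coefficient vanishes. -/
theorem bidiagonalization_orthonormal {E F : Type*} [NormedAddCommGroup E] [InnerProductSpace ℝ E]
    [NormedAddCommGroup F] [InnerProductSpace ℝ F] (T : E →ₗ[ℝ] F) (T' : F →ₗ[ℝ] E)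
    (hadj : ∀ x y, ⟪T x, y⟫_ℝ = ⟪x, T' y⟫_ℝ) (P : ℕ → F) (Q : ℕ → E) (α β : ℕ → ℝ)
    (h0 : T' (P 0) = α 0 • Q 0) (hP : ∀ j, T' (P (j + 1)) = α (j + 1) • Q (j + 1) + β j • Q j)
    (hQ : ∀ j, T (Q j) = α j • P j + β j • P (j + 1)) (k : ℕ)
    (hα : ∀ j < k, α j ≠ 0) (hβ : ∀ j < k, β j ≠ 0)
    (hPn : ∀ j ≤ k, ⟪P j, P j⟫_ℝ = 1) (hQn : ∀ j < k, ⟪Q j, Q j⟫_ℝ = 1) :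
    (∀ i ≤ k, ∀ j ≤ k, ⟪P i, P j⟫_ℝ = if i = j then 1 else 0) ∧
      ∀ i < k, ∀ j < k, ⟪Q i, Q j⟫_ℝ = if i = j then 1 else 0 := by
  induction k with
  | zero =>
    refine ⟨fun i hi j hj => ?_, fun i hi => absurd hi (Nat.not_lt_zero _)⟩
    obtain rfl : i = 0 := by omega
    obtain rfl : j = 0 := by omega
    simpa using hPn 0 le_rfl
  | succ k ih =>
    obtain ⟨ihP, ihQ⟩ := ih (fun j hj => hα j (by omega)) (fun j hj => hβ j (by omega))
      (fun j hj => hPn j (by omega)) fun j hj => hQn j (by omega)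
    -- Expanding both sides of the adjoint identity for `Q i` and `P k` leaves `α k * ⟪Q i, Q k⟫ =
    -- 0`; for `i = k - 1` the two `β` terms cancel.
    have hQk : ∀ i < k, ⟪Q k, Q i⟫_ℝ = 0 := fun i hi => by
      obtain ⟨k', rfl⟩ : ∃ k', k = k' + 1 := ⟨k - 1, by omega⟩
      have e := hadj (Q i) (P (k' + 1))
      rw [hP, hQ, inner_add_left, inner_add_right, real_inner_smul_left, real_inner_smul_left,
        real_inner_smul_right, real_inner_smul_right, ihP i (by omega) (k' + 1) le_rfl,
        ihP (i + 1) (by omega) (k' + 1) le_rfl, ihQ i hi k' (by omega), if_neg (by omega)] at e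
      have h1 : α (k' + 1) * ⟪Q i, Q (k' + 1)⟫_ℝ = 0 := by
        rcases eq_or_ne i k' with rfl | hne
        · simpa using e
        · simpa [hne] using e
      rw [real_inner_comm]
      exact (mul_eq_zero.1 h1).resolve_left (hα _ (by omega))
    have hQall : ∀ i < k + 1, ∀ j < k + 1, ⟪Q i, Q j⟫_ℝ = if i = j then 1 else 0 := by
      intro i hi j hj
      rcases eq_or_ne i j with rfl | hne
      · simpa using hQn i hi
      · rw [if_neg hne]
        rcases Nat.lt_succ_iff_lt_or_eq.1 hi with hi' | rfl
        · rcases Nat.lt_succ_iff_lt_or_eq.1 hj with hj' | rfl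
          · simpa [hne] using ihQ i hi' j hj'
          · rw [real_inner_comm]; exact hQk i hi'
        · exact hQk j (by omega)
    have hPk : ∀ i ≤ k, ⟪P (k + 1), P i⟫_ℝ = 0 := fun i hi => by
      have e := hadj (Q k) (P i)
      have h1 : ⟪Q k, T' (P i)⟫_ℝ = if k = i then α k else 0 := by
        cases i with
        | zero =>
          rw [h0, real_inner_smul_right, hQall k (by omega) 0 (by omega)]
          split_ifs with h <;> simp [h]
        | succ i =>
          rw [hP, inner_add_right, real_inner_smul_right, real_inner_smul_right,
            hQall k (by omega) (i + 1) (by omega), hQall k (by omega) i (by omega),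
            if_neg (by omega : k ≠ i)]
          split_ifs with h <;> simp [h]
      rw [h1, hQ, inner_add_left, real_inner_smul_left, real_inner_smul_left,
        ihP k le_rfl i hi] at e
      have h2 : β k * ⟪P (k + 1), P i⟫_ℝ = 0 := by
        rcases eq_or_ne k i with rfl | hne
        · simpa using e
        · simpa [hne] using e
      exact (mul_eq_zero.1 h2).resolve_left (hβ _ (by omega))
    refine ⟨fun i hi j hj => ?_, hQall⟩
    rcases eq_or_ne i j with rfl | hne
    · simpa using hPn i hi
    · rw [if_neg hne]
      rcases Nat.le_succ_iff.1 hi with hi' | rfl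
      · rcases Nat.le_succ_iff.1 hj with hj' | rfl
        · simpa [hne] using ihP i hi' j hj'
        · rw [real_inner_comm]; exact hPk i hi'
      · exact hPk j (by omega)

end Bidiagonalization

/-! ### Singular vector coordinates -/

section SVDCoordinates

open scoped InnerProductSpace

variable {m n : ℕ} {A : Matrix (Fin m) (Fin n) ℝ} {U : Matrix (Fin m) (Fin m) ℝ}
  {V : Matrix (Fin n) (Fin n) ℝ} {σ : ℕ → ℝ}

/-- The coordinates `v_lᵀ x`. -/
def rightCoord (V : Matrix (Fin n) (Fin n) ℝ) : EuclideanSpace ℝ (Fin n) →ₗ[ℝ] (Fin n → ℝ) :=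
  Vᵀ.mulVecLin ∘ₗ (WithLp.linearEquiv 2 ℝ (Fin n → ℝ)).toLinearMap

theorem rightCoord_apply (x : EuclideanSpace ℝ (Fin n)) : rightCoord V x = Vᵀ *ᵥ x.ofLp := rfl

theorem toEuclideanLin_adjoint (x : EuclideanSpace ℝ (Fin n)) (y : EuclideanSpace ℝ (Fin m)) :
    ⟪Matrix.toEuclideanLin A x, y⟫_ℝ = ⟪x, Matrix.toEuclideanLin Aᵀ y⟫_ℝ := by
  rw [← Matrix.conjTranspose_eq_transpose_of_trivial, Matrix.toEuclideanLin_conjTranspose_eq_adjoint,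
    LinearMap.adjoint_inner_right]

theorem ofLp_toEuclideanLin {ι κ : Type*} [Fintype κ] [DecidableEq κ] (M : Matrix ι κ ℝ)
    (x : EuclideanSpace ℝ κ) : (Matrix.toEuclideanLin M x).ofLp = M *ᵥ x.ofLp := rfl

theorem coeffFin_eq_mulVec (hnm : n ≤ m) (y : EuclideanSpace ℝ (Fin m)) (l : Fin n) :
    coeffFin n U y l = (Uᵀ *ᵥ y.ofLp) (l.castLE hnm) := by
  have h : (l : ℕ) + 1 - 1 < m := by have := l.2; omega
  rw [coeffFin, leftCoeff, dif_pos h]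
  rfl

theorem rectDiag_mulVec (hnm : n ≤ m) (x : Fin n → ℝ) (l : Fin n) :
    (rectDiag m n σ *ᵥ x) (l.castLE hnm) = spectrumFin n σ l * x l := by
  simp only [Matrix.mulVec, dotProduct, rectDiag, Matrix.of_apply, Fin.val_castLE, ite_mul,
    zero_mul]
  rw [Finset.sum_eq_single l]
  · simp [spectrumFin]
  · intro j _ hj
    rw [if_neg fun e => hj (Fin.ext e.symm)]
  · simp

theorem rectDiag_transpose_mulVec (hnm : n ≤ m) (y : Fin m → ℝ) (l : Fin n) :
    ((rectDiag m n σ)ᵀ *ᵥ y) l = spectrumFin n σ l * y (l.castLE hnm) := by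
  simp only [Matrix.mulVec, dotProduct, rectDiag, Matrix.transpose_apply, Matrix.of_apply, ite_mul,
    zero_mul]
  rw [Finset.sum_eq_single (l.castLE hnm)]
  · simp [spectrumFin]
  · intro j _ hj
    exact if_neg fun e => hj (Fin.ext e)
  · simp

namespace IsSVD

variable (h : IsSVD A U σ V)
include h

theorem coeffFin_apply (x : EuclideanSpace ℝ (Fin n)) (l : Fin n) :
    coeffFin n U (Matrix.toEuclideanLin A x) l = spectrumFin n σ l * rightCoord V x l := by
  have hU : Uᵀ * U = 1 := (Matrix.mem_orthogonalGroup_iff' _ _).1 h.left_orthogonal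
  have hle := h.le
  rw [coeffFin_eq_mulVec hle, ofLp_toEuclideanLin, Matrix.mulVec_mulVec, h.eq,
    ← Matrix.mul_assoc, ← Matrix.mul_assoc, hU, Matrix.one_mul, ← Matrix.mulVec_mulVec,
    rectDiag_mulVec, rightCoord_apply]

theorem rightCoord_transpose_apply (y : EuclideanSpace ℝ (Fin m)) (l : Fin n) :
    rightCoord V (Matrix.toEuclideanLin Aᵀ y) l = spectrumFin n σ l * coeffFin n U y l := by
  have hV : Vᵀ * V = 1 := (Matrix.mem_orthogonalGroup_iff' _ _).1 h.right_orthogonal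
  have hle := h.le
  rw [coeffFin_eq_mulVec hle, rightCoord_apply, ofLp_toEuclideanLin,
    Matrix.mulVec_mulVec, h.eq, Matrix.transpose_mul, Matrix.transpose_mul,
    Matrix.transpose_transpose, ← Matrix.mul_assoc, hV, Matrix.one_mul,
    ← Matrix.mulVec_mulVec, rectDiag_transpose_mulVec hle]

theorem inner_eq_sum (x y : EuclideanSpace ℝ (Fin n)) :
    ⟪x, y⟫_ℝ = ∑ l, rightCoord V x l * rightCoord V y l := by
  have hV : V * Vᵀ = 1 := (Matrix.mem_orthogonalGroup_iff _ _).1 h.right_orthogonal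
  have : (Vᵀ *ᵥ x.ofLp) ⬝ᵥ (Vᵀ *ᵥ y.ofLp) = x.ofLp ⬝ᵥ y.ofLp := by
    rw [Matrix.dotProduct_mulVec, Matrix.vecMul_transpose, Matrix.mulVec_mulVec, hV,
      Matrix.one_mulVec]
  rw [rightCoord_apply, rightCoord_apply]
  refine Eq.trans ?_ this.symm
  rw [EuclideanSpace.inner_eq_star_dotProduct, star_trivial, dotProduct_comm]

theorem inner_apply_eq_sum (x y : EuclideanSpace ℝ (Fin n)) :
    ⟪Matrix.toEuclideanLin A x, Matrix.toEuclideanLin A y⟫_ℝ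
      = ∑ l, spectrumFin n σ l ^ 2 * (rightCoord V x l * rightCoord V y l) := by
  rw [toEuclideanLin_adjoint, h.inner_eq_sum]
  refine Finset.sum_congr rfl fun l _ => ?_
  rw [h.rightCoord_transpose_apply, h.coeffFin_apply]
  ring

end IsSVD

theorem coeffFin_add (x y : EuclideanSpace ℝ (Fin m)) (hnm : n ≤ m) :
    coeffFin n U (x + y) = coeffFin n U x + coeffFin n U y := by
  ext l
  simp [coeffFin_eq_mulVec hnm, Matrix.mulVec_add]

theorem coeffFin_smul (a : ℝ) (x : EuclideanSpace ℝ (Fin m)) (hnm : n ≤ m) :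
    coeffFin n U (a • x) = a • coeffFin n U x := by
  ext l
  simp [coeffFin_eq_mulVec hnm, Matrix.mulVec_smul]

end SVDCoordinates

/-! ### Lanczos bidiagonalization in polynomial form -/

section Lanczos

open scoped InnerProductSpace

variable {m n : ℕ} {A : Matrix (Fin m) (Fin n) ℝ} {U : Matrix (Fin m) (Fin m) ℝ}
  {V : Matrix (Fin n) (Fin n) ℝ} {σ : ℕ → ℝ}

theorem norm_smul_inv_norm_smul {E : Type*} [NormedAddCommGroup E] [NormedSpace ℝ E] (x : E) :
    ‖x‖ • ‖x‖⁻¹ • x = x := by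
  rcases eq_or_ne x 0 with rfl | hx
  · simp
  · rw [smul_smul, mul_inv_cancel₀ (norm_ne_zero_iff.2 hx), one_smul]

theorem inner_inv_norm_smul_self {E : Type*} [NormedAddCommGroup E] [InnerProductSpace ℝ E] {x : E}
    (hx : ‖x‖ ≠ 0) : ⟪‖x‖⁻¹ • x, ‖x‖⁻¹ • x⟫_ℝ = 1 := by
  rw [real_inner_self_eq_norm_sq, norm_smul, norm_inv, norm_norm, inv_mul_cancel₀ hx, one_pow]

theorem transpose_apply_lanczosStep (s : LanczosState m n) :
    Matrix.toEuclideanLin Aᵀ s.p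
      = (lanczosStep A s).α • (lanczosStep A s).q + s.β • s.q := by
  simp only [lanczosStep]
  rw [norm_smul_inv_norm_smul, sub_add_cancel]

theorem apply_lanczosStep (s : LanczosState m n) :
    Matrix.toEuclideanLin A (lanczosStep A s).q
      = (lanczosStep A s).α • s.p + (lanczosStep A s).β • (lanczosStep A s).p := by
  simp only [lanczosStep]
  rw [norm_smul_inv_norm_smul, add_sub_cancel]

/-- The state `s` after `j` steps, in singular vector coordinates. -/
structure IsKrylovState (U : Matrix (Fin m) (Fin m) ℝ) (V : Matrix (Fin n) (Fin n) ℝ)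
    (σ : ℕ → ℝ) (b : EuclideanSpace ℝ (Fin m)) (j : ℕ) (s : LanczosState m n) : Prop where
  left : ∃ ψ : ℝ[X], ψ.degree = j ∧
    ∀ l, coeffFin n U s.p l = coeffFin n U b l * ψ.eval (spectrumFin n σ l ^ 2)
  right : ∃ φ : ℝ[X], φ.degree < j ∧
    rightCoord V s.q = krylovMap (spectrumFin n σ) (coeffFin n U b) φ

/-- The unnormalized new vectors have polynomials of exact degrees `j` and `j + 1`, both below `n`,
so neither vanishes at all `n` points `s_l²`. For `q` the invariant asks only `deg φ < j`, which
admits `q_0 = 0` through `φ = 0`. -/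
theorem IsKrylovState.step (h : IsSVD A U σ V) {b : EuclideanSpace ℝ (Fin m)}
    (hd : IsSpectralData (spectrumFin n σ) (coeffFin n U b)) {j : ℕ} (hj : j + 1 < n)
    {s : LanczosState m n} (hs : IsKrylovState U V σ b j s) :
    (lanczosStep A s).α ≠ 0 ∧ (lanczosStep A s).β ≠ 0 ∧
      IsKrylovState U V σ b (j + 1) (lanczosStep A s) := by
  obtain ⟨ψ, hψ, hψp⟩ := hs.left
  obtain ⟨φ, hφ, hφq⟩ := hs.right
  set s' := lanczosStep A s with hs'
  have e1 := transpose_apply_lanczosStep (A := A) s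
  have e2 := apply_lanczosStep (A := A) s
  rw [← hs'] at e1 e2
  have hdeg : (ψ - C s.β * φ).degree = j := by
    rw [degree_sub_eq_left_of_degree_lt, hψ]
    rw [hψ, ← smul_eq_C_mul]
    exact (degree_smul_le _ _).trans_lt hφ
  have hr : ∀ l, s'.α * rightCoord V s'.q l
      = krylovMap (spectrumFin n σ) (coeffFin n U b) (ψ - C s.β * φ) l := fun l => by
    have e := congrFun (congrArg (rightCoord V) e1) l
    rw [h.rightCoord_transpose_apply, hψp, map_add, map_smul, map_smul, hφq] at e
    simp only [Pi.add_apply, Pi.smul_apply, smul_eq_mul, krylovMap_apply] at e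
    simp only [krylovMap_apply, eval_sub, eval_mul, eval_C]
    linear_combination -e
  have hα : s'.α ≠ 0 := fun h0 => by
    have h1 := hd.eq_zero (p := ψ - C s.β * φ) (by rw [hdeg]; exact_mod_cast (by omega : j < n))
      (by ext l; rw [← hr, h0, zero_mul]; rfl)
    rw [h1, degree_zero] at hdeg
    exact WithBot.bot_ne_coe hdeg
  set φ' := C s'.α⁻¹ * (ψ - C s.β * φ) with hφ'
  have hφ'deg : φ'.degree = j := by rw [hφ', degree_C_mul (inv_ne_zero hα), hdeg]
  have hq : rightCoord V s'.q = krylovMap (spectrumFin n σ) (coeffFin n U b) φ' := by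
    ext l
    rw [hφ', ← smul_eq_C_mul, map_smul, Pi.smul_apply, ← hr, smul_eq_mul,
      inv_mul_cancel_left₀ hα]
  have hdeg2 : (X * φ' - C s'.α * ψ).degree = ((j + 1 : ℕ) : WithBot ℕ) := by
    have hX : (X * φ').degree = ((j + 1 : ℕ) : WithBot ℕ) := by
      rw [degree_mul, degree_X, hφ'deg, add_comm]; rfl
    rw [degree_sub_eq_left_of_degree_lt, hX]
    rw [hX, degree_C_mul hα, hψ]
    exact_mod_cast j.lt_succ_self
  have hz : ∀ l, s'.β * coeffFin n U s'.p l
      = coeffFin n U b l * (X * φ' - C s'.α * ψ).eval (spectrumFin n σ l ^ 2) := fun l => by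
    have e := congrFun (congrArg (coeffFin n U) e2) l
    rw [h.coeffFin_apply, coeffFin_add _ _ h.le, coeffFin_smul _ _ h.le, coeffFin_smul _ _ h.le,
      hq] at e
    simp only [Pi.add_apply, Pi.smul_apply, smul_eq_mul, krylovMap_apply, hψp] at e
    simp only [eval_sub, eval_mul, eval_C, eval_X]
    linear_combination -e
  have hβ : s'.β ≠ 0 := fun h0 => by
    have h1 := hd.eq_zero (p := X * φ' - C s'.α * ψ) (by rw [hdeg2]; exact_mod_cast hj) (by
      ext l
      have := hz l
      rw [h0, zero_mul] at this
      rw [krylovMap_apply, mul_assoc, ← this, mul_zero]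
      rfl)
    rw [h1, degree_zero] at hdeg2
    exact WithBot.bot_ne_coe hdeg2
  refine ⟨hα, hβ, ⟨⟨C s'.β⁻¹ * (X * φ' - C s'.α * ψ), ?_, fun l => ?_⟩, ⟨φ', ?_, hq⟩⟩⟩
  · rw [degree_C_mul (inv_ne_zero hβ), hdeg2]
  · rw [eval_mul, eval_C, mul_left_comm, ← hz, inv_mul_cancel_left₀ hβ]
  · rw [hφ'deg]; exact_mod_cast j.lt_succ_self

theorem isKrylovState_lanczosState (h : IsSVD A U σ V) {b : EuclideanSpace ℝ (Fin m)}
    (hb : b ≠ 0) (hd : IsSpectralData (spectrumFin n σ) (coeffFin n U b)) (j : ℕ) (hj : j < n) :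
    IsKrylovState U V σ b j (lanczosState A b j) := by
  induction j with
  | zero =>
    refine ⟨⟨C ‖b‖⁻¹, ?_, fun l => ?_⟩, ⟨0, ?_, ?_⟩⟩
    · rw [degree_C (inv_ne_zero (norm_ne_zero_iff.2 hb))]; rfl
    · rw [lanczosState, coeffFin_smul _ _ h.le, eval_C, mul_comm]; rfl
    · rw [degree_zero]; exact WithBot.bot_lt_coe _
    · rw [lanczosState, map_zero, map_zero]
  | succ j ih => exact ((ih (by omega)).step h hd hj).2.2

theorem lanczosState_orthonormal (h : IsSVD A U σ V) {b : EuclideanSpace ℝ (Fin m)}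
    (hb : b ≠ 0) (hd : IsSpectralData (spectrumFin n σ) (coeffFin n U b)) {k : ℕ} (hk : k < n) :
    (∀ i ≤ k, ∀ j ≤ k, ⟪(lanczosState A b i).p, (lanczosState A b j).p⟫_ℝ = if i = j then 1 else 0) ∧
      ∀ i < k, ∀ j < k, ⟪(lanczosState A b (i + 1)).q, (lanczosState A b (j + 1)).q⟫_ℝ
        = if i = j then 1 else 0 := by
  have hne : ∀ j < k, (lanczosState A b (j + 1)).α ≠ 0 ∧ (lanczosState A b (j + 1)).β ≠ 0 :=
    fun j hj =>
      let H := (isKrylovState_lanczosState h hb hd j (by omega)).step h hd (by omega)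
      ⟨H.1, H.2.1⟩
  refine bidiagonalization_orthonormal (Matrix.toEuclideanLin A) (Matrix.toEuclideanLin Aᵀ)
    toEuclideanLin_adjoint (fun j => (lanczosState A b j).p) (fun j => (lanczosState A b (j + 1)).q)
    (fun j => (lanczosState A b (j + 1)).α) (fun j => (lanczosState A b (j + 1)).β) ?_
    (fun j => transpose_apply_lanczosStep _) (fun j => apply_lanczosStep _) k
    (fun j hj => (hne j hj).1) (fun j hj => (hne j hj).2) (fun j hj => ?_) (fun j hj => ?_)
  · have := transpose_apply_lanczosStep (A := A) (lanczosState A b 0)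
    have h0 : (lanczosState A b 0).β = 0 := rfl
    rw [h0, zero_smul, add_zero] at this
    exact this
  · cases j with
    | zero => exact inner_inv_norm_smul_self (norm_ne_zero_iff.2 hb)
    | succ j => exact inner_inv_norm_smul_self (hne j (by omega)).2
  · exact inner_inv_norm_smul_self (hne j hj).1

/-- Column `j` of `A Q_k = P_{k+1} B_k`. -/
theorem apply_lanczosState_q (b : EuclideanSpace ℝ (Fin m)) (k : ℕ) (j : Fin k) :
    Matrix.toEuclideanLin A (lanczosState A b (j + 1)).q
      = ∑ i : Fin (k + 1), lanczosB A b k i j • (lanczosState A b i).p := by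
  have hterm : ∀ i : Fin (k + 1), lanczosB A b k i j • (lanczosState A b i).p
      = (if i = j.castSucc then (lanczosState A b (j + 1)).α • (lanczosState A b i).p else 0)
        + if i = j.succ then (lanczosState A b (j + 1)).β • (lanczosState A b i).p else 0 := by
    intro i
    simp only [lanczosB, Matrix.of_apply, Fin.ext_iff, Fin.val_castSucc, Fin.val_succ]
    by_cases h1 : (i : ℕ) = j
    · simp [h1]
    · by_cases h2 : (i : ℕ) = j + 1 <;> simp [h1, h2]
  simp_rw [hterm]
  rw [Finset.sum_add_distrib, Finset.sum_ite_eq', Finset.sum_ite_eq']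
  simp only [Fin.val_castSucc, Fin.val_succ, Finset.mem_univ, if_true]
  exact apply_lanczosStep _

/-- The Ritz values come from the Rayleigh–Ritz procedure on the Krylov space. -/
theorem exists_isRitzSystem (h : IsSVD A U σ V) {b : EuclideanSpace ℝ (Fin m)}
    (hb : b ≠ 0) (hd : IsSpectralData (spectrumFin n σ) (coeffFin n U b)) {k : ℕ} (hk : k < n) :
    ∃ g : Fin k → Fin n → ℝ, IsRitzSystem (spectrumFin n σ) (coeffFin n U b) g
      fun i => ritzValue A b k (i + 1) := by
  obtain ⟨hP, hQ⟩ := lanczosState_orthonormal h hb hd hk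
  set P : Fin (k + 1) → EuclideanSpace ℝ (Fin m) := fun i => (lanczosState A b i).p with hPdef
  set Q : Fin k → EuclideanSpace ℝ (Fin n) := fun i => (lanczosState A b (i + 1)).q with hQdef
  have hPo : Orthonormal ℝ P := orthonormal_iff_ite.2 fun i j => by
    simpa [Fin.ext_iff] using hP i (by omega) j (by omega)
  have hQo : Orthonormal ℝ Q := orthonormal_iff_ite.2 fun i j => by
    simpa [Fin.ext_iff] using hQ i i.2 j j.2
  set T := Matrix.toEuclideanLin (lanczosB A b k) with hT
  have hn : Module.finrank ℝ (EuclideanSpace ℝ (Fin k)) = k := by simp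
  -- By orthonormality `‖A Q_k y‖ = ‖B_k y‖`, so `Q_k` maps the eigenvectors of `B_kᵀB_k` to Ritz
  -- vectors.
  set f := T.isSymmetric_adjoint_comp_self.eigenvectorBasis hn with hf
  set J : EuclideanSpace ℝ (Fin k) → EuclideanSpace ℝ (Fin n) := fun y => ∑ j, y j • Q j with hJ
  have hAJ : ∀ y, Matrix.toEuclideanLin A (J y) = ∑ i, T y i • P i := fun y => by
    simp only [hJ, hPdef, hQdef, map_sum, map_smul, apply_lanczosState_q, Finset.smul_sum]
    rw [Finset.sum_comm]
    refine Finset.sum_congr rfl fun i _ => ?_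
    rw [hT, ofLp_toEuclideanLin, Matrix.mulVec, dotProduct, Finset.sum_smul]
    exact Finset.sum_congr rfl fun j _ => by rw [smul_smul, mul_comm]
  have hθ : ∀ i : Fin k, ritzValue A b k (i + 1) = T.singularValues i := fun i => rfl
  refine ⟨fun i => rightCoord V (J (f i)), ⟨fun i j => ?_, fun i j => ?_, fun i => ?_,
    fun i j hij => ?_, fun i => T.singularValues_nonneg _⟩⟩
  · simp only [one_mul]
    rw [← h.inner_eq_sum, hJ, hQo.inner_sum, ← orthonormal_iff_ite.1 f.orthonormal i j,
      PiLp.inner_apply]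
    exact Finset.sum_congr rfl fun l _ => by rw [RCLike.inner_apply, mul_comm]
  · rw [← h.inner_apply_eq_sum, hAJ, hAJ, hPo.inner_sum, hθ, T.sq_singularValues_fin hn]
    have e : ⟪T (f i), T (f j)⟫_ℝ
        = T.isSymmetric_adjoint_comp_self.eigenvalues hn i * ⟪f i, f j⟫_ℝ := by
      rw [← LinearMap.adjoint_inner_left, ← LinearMap.comp_apply, hf,
        LinearMap.IsSymmetric.apply_eigenvectorBasis, real_inner_smul_left]
      rfl
    rw [orthonormal_iff_ite.1 f.orthonormal i j, mul_ite, mul_one, mul_zero,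
      PiLp.inner_apply] at e
    rw [← e]
    exact Finset.sum_congr rfl fun l _ => by rw [RCLike.inner_apply, mul_comm]
  · have hφ : ∀ j : Fin k, ∃ φ ∈ degreeLT ℝ k,
        krylovMap (spectrumFin n σ) (coeffFin n U b) φ = rightCoord V (Q j) := fun j => by
      obtain ⟨φ, hφ, hφq⟩ := (isKrylovState_lanczosState h hb hd (j + 1) (by omega)).right
      exact ⟨φ, mem_degreeLT.2 (hφ.trans_le (Nat.cast_le.2 j.2)), hφq.symm⟩
    choose φ hφ hφq using hφ
    refine ⟨∑ j, f i j • φ j, Submodule.sum_mem _ fun j _ => Submodule.smul_mem _ _ (hφ j), ?_⟩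
    simp only [hJ, map_sum, map_smul, hφq]
  · exact T.singularValues_antitone hij

end Lanczos

/-! ### Consequences of the decay models -/

section Models

variable {m n : ℕ} {σ : ℕ → ℝ}

theorem IsSVD.lt_of_lt {A : Matrix (Fin m) (Fin n) ℝ} {U : Matrix (Fin m) (Fin m) ℝ}
    {V : Matrix (Fin n) (Fin n) ℝ} (h : IsSVD A U σ V) {i j : ℕ} (hi : 1 ≤ i) (hij : i < j)
    (hj : j ≤ n) : σ j < σ i := by
  induction j, hij using Nat.le_induction with
  | base => exact h.decreasing i hi hj
  | succ j hij ih => exact (h.decreasing j (by omega) hj).trans (ih (by omega))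

theorem IsSVD.isSpectralData {A : Matrix (Fin m) (Fin n) ℝ} {U : Matrix (Fin m) (Fin m) ℝ}
    {V : Matrix (Fin n) (Fin n) ℝ} (h : IsSVD A U σ V) {b : EuclideanSpace ℝ (Fin m)}
    (hb : ∀ i, 1 ≤ i → i ≤ n → leftCoeff U b i ≠ 0) :
    IsSpectralData (spectrumFin n σ) (coeffFin n U b) where
  pos l := h.pos _ (by omega) (by omega)
  anti i j hij := h.lt_of_lt (by omega) (by have := Fin.lt_def.1 hij; omega) (by omega)
  coeff_ne l := hb _ (by omega) (by omega)

theorem SevereModel.sq_eq {ζ ρ : ℝ} (h : SevereModel n σ ζ ρ) (l : Fin n) :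
    spectrumFin n σ l ^ 2 = ζ ^ 2 * (ρ ^ 2)⁻¹ * (ρ ^ 2)⁻¹ ^ (l : ℕ) := by
  rw [spectrumFin, h.2 _ (by omega) (by omega), zpow_neg, mul_pow, mul_assoc, ← pow_succ', inv_pow,
    inv_pow, ← pow_mul]
  norm_cast
  rw [← pow_mul, mul_comm 2]

/-- `(1 + √2)² = 3 + 2√2` exceeds `5`, which is all the geometric estimate requires. -/
theorem inv_sq_le_of_one_add_sqrt_two_le {ρ : ℝ} (h : 1 + √2 ≤ ρ) : (ρ ^ 2)⁻¹ ≤ 1 / 5 := by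
  have h2 : (7 / 5 : ℝ) ≤ √2 := Real.le_sqrt_of_sq_le (by norm_num)
  rw [one_div]
  refine inv_anti₀ (by norm_num) ?_
  nlinarith

/-- The ratio `σ_k / σ_{k+1} = ((k + 1) / k)^α` decreases in `k`, so `k₀` is the worst case. -/
theorem ModerateModel.ratio_mul_le {ζ α : ℝ} (h : ModerateModel n σ ζ α) (hζ : 0 < ζ) {k k₀ : ℕ}
    (hk : 1 ≤ k) (hkk : k ≤ k₀) (hk₀ : k₀ + 1 ≤ n) :
    (((k₀ : ℝ) + 1) / k₀) ^ α * σ (k + 1) ≤ σ k := by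
  have hα : 0 ≤ α := by linarith [h.1]
  have hkpos : (0 : ℝ) < k := by exact_mod_cast hk
  have hkk' : (k : ℝ) ≤ k₀ := by exact_mod_cast hkk
  have hσ : σ k = (((k : ℝ) + 1) / k) ^ α * σ (k + 1) := by
    rw [h.2 k hk (by omega), h.2 (k + 1) (by omega) (by omega), Real.div_rpow (by positivity)
      hkpos.le, Real.rpow_neg hkpos.le, Real.rpow_neg (by positivity)]
    push_cast
    have : 0 < ((k : ℝ) + 1) ^ α := by positivity
    field_simp
  rw [hσ]
  refine mul_le_mul_of_nonneg_right (Real.rpow_le_rpow (by positivity) ?_ hα) ?_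
  · rw [div_le_div_iff₀ (by linarith) hkpos]
    linarith
  · rw [h.2 (k + 1) (by omega) (by omega)]
    positivity

end Models

end RitzValues

/-! ### The main theorem -/

theorem mainTheorem2 {m n : ℕ} (A : Matrix (Fin m) (Fin n) ℝ)
    (U : Matrix (Fin m) (Fin m) ℝ) (V : Matrix (Fin n) (Fin n) ℝ) (σ : ℕ → ℝ)
    (hsvd : IsSVD A U σ V)
    -- noisy right-hand side and discrete Picard condition
    (b bhat e : EuclideanSpace ℝ (Fin m)) (hb : b = bhat + e)
    (β : ℝ) (hβ : 0 < β)
    (hpicard : ∀ i, 1 ≤ i → i ≤ n → |leftCoeff U bhat i| = σ i ^ (1 + β))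
    (hnonzero : ∀ i, 1 ≤ i → i ≤ n → leftCoeff U b i ≠ 0)
    (hmono : ∀ i, 1 ≤ i → i + 1 ≤ n → |leftCoeff U b (i + 1)| ≤ |leftCoeff U b i|)
    -- severely or moderately ill-posed problem
    (ζ ρ α : ℝ) (hζ : 0 < ζ)
    (hmodel : SevereModel n σ ζ ρ ∨ ModerateModel n σ ζ α) :
    -- the Ritz values are simple and approximate the large singular values from below
    (∀ k, 1 ≤ k → k + 1 ≤ n →
      (∀ i, 1 ≤ i → i + 1 ≤ k → ritzValue A b k (i + 1) < ritzValue A b k i) ∧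
      ∀ i, 1 ≤ i → i ≤ k →
        0 < σ i - ritzValue A b k i ∧
        σ i - ritzValue A b k i ≤ √(1 + etaK n U σ b k ^ 2) * σ (k + 1)) ∧
    -- strict interlacing in natural order up to the transition index
    ∀ k₀, 1 ≤ k₀ → k₀ + 1 ≤ n →
      ((SevereModel n σ ζ ρ ∧ 1 + √2 ≤ ρ) ∨
        (ModerateModel n σ ζ α ∧ ∀ k, 1 ≤ k → k ≤ k₀ →
          1 + √(1 + etaK n U σ b k ^ 2) < (((k₀ : ℝ) + 1) / k₀) ^ α)) →
      ∀ k, 1 ≤ k → k ≤ k₀ → ∀ i, 1 ≤ i → i ≤ k →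
        σ (i + 1) < ritzValue A b k i ∧ ritzValue A b k i < σ i ∧
        ¬ ritzValue A b k i < σ (k₀ + 1) := by
  have hd := hsvd.isSpectralData hnonzero
  have hbne : 1 ≤ n → b ≠ 0 := fun hn h0 => hnonzero 1 le_rfl hn (by simp [h0, leftCoeff])
  have habs : ∀ i j : Fin n, i ≤ j → |coeffFin n U b j| ≤ |coeffFin n U b i| := by
    have key : ∀ i j : ℕ, i ≤ j → 1 ≤ i → j ≤ n → |leftCoeff U b j| ≤ |leftCoeff U b i| := by
      intro i j hij hi
      induction j, hij using Nat.le_induction with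
      | base => exact fun _ => le_rfl
      | succ j hij ih => exact fun hj => (hmono j (by omega) hj).trans (ih (by omega))
    exact fun i j hij => key _ _ (by have := Fin.le_def.1 hij; omega) (by omega) (by omega)
  have hsystem : ∀ k, k + 1 ≤ n → ∃ g : Fin k → Fin n → ℝ,
      IsRitzSystem (spectrumFin n σ) (coeffFin n U b) g fun i => ritzValue A b k (i + 1) :=
    fun k hk => exists_isRitzSystem hsvd (hbne (by omega)) hd hk
  have hupper : ∀ k, k + 1 ≤ n → ∀ i, 1 ≤ i → i ≤ k → ritzValue A b k i < σ i := by
    intro k hk i hi hik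
    obtain ⟨g, hg⟩ := hsystem k hk
    obtain ⟨i, rfl⟩ : ∃ j, i = j + 1 := ⟨i - 1, by omega⟩
    exact hg.lt_singularValue hd hk ⟨i, hik⟩
  have hlower : ∀ k, k + 1 ≤ n → ∀ i, 1 ≤ i → i ≤ k →
      σ i - ritzValue A b k i ≤ √(1 + etaK n U σ b k ^ 2) * σ (k + 1) := by
    intro k hk i hi hik
    obtain ⟨g, hg⟩ := hsystem k hk
    obtain ⟨i, rfl⟩ : ∃ j, i = j + 1 := ⟨i - 1, by omega⟩
    exact singularValue_sub_ritz_le hd hk hg ⟨i, hik⟩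
  refine ⟨fun k hk hkn => ⟨fun i hi hik => ?_, fun i hi hik =>
    ⟨sub_pos.2 (hupper k hkn i hi hik), hlower k hkn i hi hik⟩⟩, ?_⟩
  · obtain ⟨g, hg⟩ := hsystem k hkn
    obtain ⟨i, rfl⟩ : ∃ j, i = j + 1 := ⟨i - 1, by omega⟩
    exact hg.strictAnti hd (by omega) (a := ⟨i, by omega⟩) (b := ⟨i + 1, hik⟩)
      (Fin.lt_def.2 (Nat.lt_succ_self i))
  · intro k₀ hk₀ hk₀n hcase k hk hkk₀ i hi hik
    -- The bound is proved on the `i`-th Krylov space, independently of `k`.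
    have henergy : ∀ p ∈ Polynomial.degreeLT ℝ i, p ≠ 0 →
        σ (i + 1) ^ 2 * ∑ l, krylovMap (spectrumFin n σ) (coeffFin n U b) p l ^ 2
          < ∑ l, spectrumFin n σ l ^ 2
            * krylovMap (spectrumFin n σ) (coeffFin n U b) p l ^ 2 := by
      obtain ⟨i, rfl⟩ : ∃ j, i = j + 1 := ⟨i - 1, by omega⟩
      intro p hp hp0
      rcases hcase with ⟨hsev, hρ⟩ | ⟨hmod, hη⟩
      · have hρ0 : 0 < ρ := by linarith [hsev.1]
        exact hd.lt_energy_of_geometric habs (a := ζ ^ 2 * (ρ ^ 2)⁻¹) (q := (ρ ^ 2)⁻¹)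
          (by positivity) (by positivity) (inv_sq_le_of_one_add_sqrt_two_le hρ) hsev.sq_eq
          (by omega : i + 1 < n) hp hp0
      -- At step `i + 1` the smallest Ritz value is at least `σ_{i+1} - √(1 + η²) σ_{i+2}`, and
      -- `σ_{i+1} > (1 + √(1 + η²)) σ_{i+2}`.
      · obtain ⟨g, hg⟩ := hsystem (i + 1) (by omega)
        have hσ := hsvd.pos (i + 1 + 1) (by omega) (by omega)
        refine hg.lt_energy_of_lt_last hd (by omega) ⟨i, Nat.lt_succ_self i⟩ rfl hσ.le ?_ hp hp0
        have h1 := hlower (i + 1) (by omega) (i + 1) (by omega) le_rfl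
        have h2 := hmod.ratio_mul_le hζ hi (hik.trans hkk₀) hk₀n
        have h3 := mul_lt_mul_of_pos_right (hη (i + 1) hi (hik.trans hkk₀)) hσ
        change σ (i + 1 + 1) < ritzValue A b (i + 1) (i + 1)
        linarith
    have hlt : σ (i + 1) < ritzValue A b k i := by
      obtain ⟨g, hg⟩ := hsystem k (by omega)
      obtain ⟨i, rfl⟩ : ∃ j, i = j + 1 := ⟨i - 1, by omega⟩
      exact hg.lt_of_forall_energy ⟨i, hik⟩ _ henergy
    refine ⟨hlt, hupper k (by omega) i hi hik, not_lt.2 (le_trans ?_ hlt.le)⟩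
    rcases (by omega : i = k₀ ∨ i < k₀) with rfl | h
    · exact le_rfl
    · exact (hsvd.lt_of_lt (by omega) (by omega) hk₀n).le
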